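/- **Theorem (Quantum gradient algorithm: queries and resources).** Let $n,d,k\ge 0$ be integers, $N=2^n$, $M=2^k$, $m=dk$. Let $X$ be a Hermitian $N\times N$ matrix, let $\Delta_1,\dots,\Delta_d$ be Hermitian $N\times N$ matrices (the directions of differentiation), and put $X(x)=X+\sum_{i=1}^d x_i\Delta_i$ for $x\in\mathbb R^d$. Let $\Psi\in\mathbb C^N$ be a unit vector with $X\Psi=\lambda\Psi$. An *eigenvalue branch* through $(\lambda,\Psi)$ with gradient $g\in\mathbb R^d$ is a pair of functions $f:\mathbb R^d\to\mathbb R$, $\psi:\mathbb R^d\to\mathbb C^N$ with $X(x)\psi(x)=f(x)\psi(x)$ for all $x$ near $0$, $f(0)=\lambda$, $\psi(0)=\Psi$, $\psi$ continuous at $0$, and $f$ differentiable at $0$ with $\nabla f(0)=g$. The circuit acts on an $n$-qubit register, prepared in $\Psi$, and an $m$-qubit register made of $d$ blocks of $k$ qubits, prepared in $|0\cdots0\rangle$. It applies a Hadamard gate to every qubit of the $m$-qubit register, then the oracle $\sum_\varepsilon|\varepsilon\rangle\langle\varepsilon|\otimes U(\varepsilon)$, $\varepsilon\in\{0,\dots,M-1\}^d$,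 and then the inverse quantum Fourier transform $\frac1{\sqrt M}\sum_{j,l}e^{-2\pi i jl/M}|j\rangle\langle l|$ to each block; finally the $m$-qubit register is measured, with outcome $j\in\{0,\dots,M-1\}^d$. For $W,L>0$ write $x_\varepsilon=\frac LM\left(\varepsilon-\frac M2(1,\dots,1)\right)$. A family $U(\varepsilon)$ of unitary $N\times N$ matrices is a *phase oracle* for $(f,\psi)$ with parameters $W,L$ if $U(\varepsilon)\psi(x_\varepsilon)=e^{2\pi i\frac{M}{WL}f(x_\varepsilon)}\psi(x_\varepsilon)$ for all $\varepsilon$. Then: 1. The circuit queries the oracle exactly once, whatever $n,d,k$ are; its two registers have $n=\log_2 N$ and $m=\log_2 M^d$ qubits, where $N$ and $M^d$ are the numbers of their basis states; and it is unitary whenever all $U(\varepsilon)$ are. 2. If $\lambda$ is a simple eigenvalue of $X$, there is an eigenvalue branch through $(\lambda,\Psi)$. 3. Let $(f,\psi)$ be any eigenvalue branch through $(\lambda,\Psi)$, with gradient $g$, and let $W>0$. For all sufficiently small $L>0$ the time evolution $U(\varepsilon)=\exp\left(\frac{2\pi i M}{WL}X(x_\varepsilon)\right)$ is a phase oracle for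 $(f,\psi)$ with parameters $W,L$. Moreover, for every choice of unitary families $U_L$ that are phase oracles for $(f,\psi)$ with parameters $W,L$ for all sufficiently small $L>0$, the following holds as $L\to0^+$: (a) Up to global phases $\alpha_L$, $|\alpha_L|=1$, the output state converges to $\sum_j c_j|j\rangle\otimes\Psi$, where $c_j=\prod_{i=1}^d\frac1M\sum_{l=0}^{M-1}e^{-2\pi i l\left(j_i-\frac MWg_i\right)/M}$; so the probability of each outcome $j$ converges to $|c_j|^2$. (b) If $Wj_i/M\equiv g_i \pmod{W}$ for every $i$ (in particular if $j_i=\frac MWg_i$), the probability of the outcome $j$ converges to $1$. (c) If $Wj_i/M$ is within $\frac{W}{2M}$ of $g_i$ modulo $W$ for every $i$, then for each $\eta>0$ the outcome $j$ has probability at least $(4/\pi^2)^d-\eta$ for all sufficiently small $L>0$. (d) For all real $r>1$ and $\eta>0$, for all sufficiently small $L>0$ the outcome $j$ satisfies, with probability at least $1-\frac{d}{2(r-1)}-\eta$, that for every $i$ the number $Wj_i/M$ is within $rW/M$ of $g_i$ modulo $W$. Here $a$ is within $\delta$ of $b$ modulo $W$ if $|a-b-zW|\le\delta$ for some $z\in\mathbb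 Z$. -/

import Mathlib

open Filter Topology
open scoped Kronecker Matrix

noncomputable section

namespace QGrad

/-- Computational basis of a register of `n` qubits: bit strings of length `n`. -/
abbrev System (n : ℕ) : Type := Fin n → Fin 2

/-- Computational basis of the answer register: one block of `k` qubits for each of the
`d` directions of differentiation, hence `d * k` qubits in all. -/
abbrev Answer (d k : ℕ) : Type := Fin d × Fin k → Fin 2

/-- The integer in `{0, …, 2 ^ k - 1}` written in binary in block `i`
(bit `q` has weight `2 ^ q`). -/
def Answer.value {d k : ℕ} (a : Answer d k) (i : Fin d) : Fin (2 ^ k) :=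
  finFunctionFinEquiv fun q => a (i, q)

/-! ### Circuits -/

/-- The gates of a circuit with oracle access: a Hadamard gate on one qubit of the answer
register, the inverse quantum Fourier transform of one block, and one query of the oracle. -/
inductive Gate (d k : ℕ) : Type
  | hadamard (w : Fin d × Fin k) : Gate d k
  | invQFT (i : Fin d) : Gate d k
  | oracle : Gate d k

/-- The one-qubit Hadamard matrix. -/
def hadamardMatrix : Matrix (Fin 2) (Fin 2) ℂ :=
  ((1 / Real.sqrt 2 : ℝ) : ℂ) • !![1, 1; 1, -1]

/-- The Hadamard matrix on qubit `w` of the answer register, the identity on the others. -/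
def hadamardOn {d k : ℕ} (w : Fin d × Fin k) : Matrix (Answer d k) (Answer d k) ℂ :=
  Matrix.of fun a b => if ∀ v, v ≠ w → a v = b v then hadamardMatrix (a w) (b w) else 0

/-- The inverse quantum Fourier transform
`(1 / √M) ∑ j l, exp (-2 π i j l / M) |j⟩⟨l|`, `M = 2 ^ k`, on block `i` of the answer register,
the identity on the other blocks. -/
def invQFTOn {d k : ℕ} (i : Fin d) : Matrix (Answer d k) (Answer d k) ℂ :=
  Matrix.of fun a b => if ∀ v : Fin d × Fin k, v.1 ≠ i → a v = b v then
    ((1 / Real.sqrt (2 ^ k) : ℝ) : ℂ) *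
      Complex.exp (-(2 * Real.pi * Complex.I * ((a.value i : ℕ) : ℂ) * ((b.value i : ℕ) : ℂ)
        / 2 ^ k))
  else 0

/-- The controlled operator `∑ ε, |ε⟩⟨ε| ⊗ U ε`. -/
def controlled {n d k : ℕ} (U : (Fin d → Fin (2 ^ k)) → Matrix (System n) (System n) ℂ) :
    Matrix (Answer d k × System n) (Answer d k × System n) ℂ :=
  Matrix.of fun p q => if p.1 = q.1 then U p.1.value p.2 q.2 else 0

/-- The matrix of a gate on both registers when the oracle is the controlled operator of `U`. -/
def Gate.toMatrix {n d k : ℕ} (U : (Fin d → Fin (2 ^ k)) → Matrix (System n) (System n) ℂ) :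
    Gate d k → Matrix (Answer d k × System n) (Answer d k × System n) ℂ
  | .hadamard w => hadamardOn w ⊗ₖ (1 : Matrix (System n) (System n) ℂ)
  | .invQFT i => invQFTOn i ⊗ₖ (1 : Matrix (System n) (System n) ℂ)
  | .oracle => controlled U

/-- The number of oracle queries of a gate. -/
def Gate.queries {d k : ℕ} : Gate d k → ℕ
  | .hadamard _ => 0
  | .invQFT _ => 0
  | .oracle => 1

/-- The number of oracle queries of a circuit (a list of gates). -/
def queries {d k : ℕ} (C : List (Gate d k)) : ℕ := (C.map Gate.queries).sum

/-- The operator of a circuit; the first gate of the list acts first. -/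
def eval {n d k : ℕ} (U : (Fin d → Fin (2 ^ k)) → Matrix (System n) (System n) ℂ) :
    List (Gate d k) → Matrix (Answer d k × System n) (Answer d k × System n) ℂ
  | [] => 1
  | g :: C => eval U C * g.toMatrix U

/-- The gradient circuit: a Hadamard gate on every qubit of the answer register, the oracle,
and the inverse quantum Fourier transform on every block. -/
def gradientCircuit (d k : ℕ) : List (Gate d k) :=
  ((List.finRange d).flatMap fun i => (List.finRange k).map fun q => Gate.hadamard (i, q))
    ++ [Gate.oracle] ++ (List.finRange d).map Gate.invQFT

/-- The input `|0 … 0⟩ ⊗ Ψ`. -/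
def inputState {n : ℕ} (d k : ℕ) (Ψ : System n → ℂ) : Answer d k × System n → ℂ :=
  fun p => if p.1 = 0 then Ψ p.2 else 0

/-- The final state of the gradient circuit on the input `|0 … 0⟩ ⊗ Ψ`. -/
def outputState {n d k : ℕ} (U : (Fin d → Fin (2 ^ k)) → Matrix (System n) (System n) ℂ)
    (Ψ : System n → ℂ) : Answer d k × System n → ℂ :=
  eval U (gradientCircuit d k) *ᵥ inputState d k Ψ

/-- The probability that measuring the answer register of a state in the computational basis
gives an outcome in `S`. -/
def measureProb {n d k : ℕ} (φ : Answer d k × System n → ℂ) (S : Set (Answer d k)) : ℝ :=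
  ∑ a, S.indicator (fun a => ∑ s, ‖φ (a, s)‖ ^ 2) a

/-! ### The eigenvalue and its gradient -/

/-- The perturbed matrix `X + ∑ i, x i • Δ i`. -/
def perturbed {n d : ℕ} (X : Matrix (System n) (System n) ℂ)
    (Δ : Fin d → Matrix (System n) (System n) ℂ) (x : EuclideanSpace ℝ (Fin d)) :
    Matrix (System n) (System n) ℂ :=
  X + ∑ i, ((x i : ℝ) : ℂ) • Δ i

/-- Near `0`, `f` is an eigenvalue of the perturbed matrix with eigenvector `ψ`, continued from
the eigenpair `(lam, Ψ)` at `0`, and `g` is the gradient of `f` at `0`. -/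
structure IsEigenvalueBranch {n d : ℕ} (X : Matrix (System n) (System n) ℂ)
    (Δ : Fin d → Matrix (System n) (System n) ℂ) (lam : ℝ) (Ψ : System n → ℂ)
    (f : EuclideanSpace ℝ (Fin d) → ℝ) (ψ : EuclideanSpace ℝ (Fin d) → System n → ℂ)
    (g : EuclideanSpace ℝ (Fin d)) : Prop where
  eigen : ∀ᶠ x in 𝓝 0, perturbed X Δ x *ᵥ ψ x = ((f x : ℝ) : ℂ) • ψ x
  value_zero : f 0 = lam
  vector_zero : ψ 0 = Ψ
  continuousAt : ContinuousAt ψ 0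
  gradient : HasGradientAt f g 0

/-! ### The oracle -/

/-- The point `(L / M) (ε - M / 2)`, `M = 2 ^ k`, of the grid of side `L`. -/
def gridPoint {d k : ℕ} (L : ℝ) (ε : Fin d → Fin (2 ^ k)) : EuclideanSpace ℝ (Fin d) :=
  WithLp.toLp 2 fun i => L / 2 ^ k * (((ε i : ℕ) : ℝ) - 2 ^ k / 2)

/-- `U` is a phase oracle for the eigenvalue `f`: controlled on `ε`, a unitary that multiplies
the eigenvector at the grid point of `ε` by `exp (2 π i (M / (W L)) f)`, `M = 2 ^ k`. -/
def IsPhaseOracle {n d k : ℕ} (f : EuclideanSpace ℝ (Fin d) → ℝ)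
    (ψ : EuclideanSpace ℝ (Fin d) → System n → ℂ) (W L : ℝ)
    (U : (Fin d → Fin (2 ^ k)) → Matrix (System n) (System n) ℂ) : Prop :=
  ∀ ε, U ε ∈ Matrix.unitaryGroup (System n) ℂ ∧
    U ε *ᵥ ψ (gridPoint L ε) =
      Complex.exp (((2 * Real.pi * (2 ^ k / (W * L)) * f (gridPoint L ε) : ℝ) : ℂ) * Complex.I) •
        ψ (gridPoint L ε)

/-- The time evolution `exp (2 π i (M / (W L)) (X + ∑ i, x i • Δ i))`, `M = 2 ^ k`, where `x` is
the grid point of `ε`. -/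
def timeEvolution {n d k : ℕ} (X : Matrix (System n) (System n) ℂ)
    (Δ : Fin d → Matrix (System n) (System n) ℂ) (W L : ℝ) (ε : Fin d → Fin (2 ^ k)) :
    Matrix (System n) (System n) ℂ :=
  NormedSpace.exp ((((2 * Real.pi * (2 ^ k / (W * L)) : ℝ) : ℂ) * Complex.I) •
    perturbed X Δ (gridPoint L ε))

/-! ### The ideal output -/

/-- The amplitude `∏ i, (1 / M) ∑ l, exp (-2 π i l (jᵢ - (M / W) gᵢ) / M)`, `M = 2 ^ k`, of the
outcome `j`: the inverse Fourier transform of the plane wave of frequency `g / W`. -/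
def idealAmplitude {d k : ℕ} (W : ℝ) (g : EuclideanSpace ℝ (Fin d)) (a : Answer d k) : ℂ :=
  ∏ i, (1 / 2 ^ k : ℂ) * ∑ l : Fin (2 ^ k),
    Complex.exp (-(2 * Real.pi * Complex.I * ((l : ℕ) : ℂ)
      * (((((a.value i : ℕ) : ℝ) - 2 ^ k / W * g i : ℝ) : ℂ)) / 2 ^ k))

/-- The outcomes `j` for which the readout `W jᵢ / M`, `M = 2 ^ k`, of every component agrees with
`gᵢ` modulo `W` up to an error of at most `δ`. -/
def accurate {d k : ℕ} (W : ℝ) (g : EuclideanSpace ℝ (Fin d)) (δ : ℝ) : Set (Answer d k) :=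
  {a | ∀ i, ∃ z : ℤ, |W * ((a.value i : ℕ) : ℝ) / 2 ^ k - g i - z * W| ≤ δ}

end QGrad

end

/-! Hadamards spread the answer register uniformly over all `ε`, and one controlled query multiplies
each branch by a phase proportional to `f` at the grid point of `ε`. As `L → 0` that phase is a term
independent of `ε`, which diverges like `1 / L`, plus a part that tends to `(2π / W) ∑ i, g i * ε
i`, because `(f (gridPoint L ε) - lam) / L` tends to a directional derivative of `f`
(`tendsto_phase`). Up to a global phase the register thus becomes a product of plane waves, one for
each partial derivative, and the inverse Fourier transforms perform an independent phase estimation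
in every block.

The oracle is controlled on `ψ (gridPoint L ε)` but is applied to `Ψ`. Unitarity bounds the error by
the distance between the two vectors, which vanishes by continuity (`tendsto_oracle_mulVec`).
Nothing else about the oracle enters, so the limit is the same for all phase oracles.

The limiting distribution is a product of squared Dirichlet kernels. Summing the geometric series
(`norm_dirichletMean_mul`) and bounding sines on both sides gives the constant `4 / π ^ 2` and an
inverse-square tail; a telescoping sum and a union bound over the components then give the
probability of an accurate readout.

For a simple eigenvalue the branch comes from the implicit function theorem, applied to the
eigenvalue equation together with the linear normalization `star Ψ ⬝ᵥ v = 1`, which fixes the scale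
and the phase of the eigenvector. -/

noncomputable section

namespace QGrad

/-! ### Tensor products of matrices -/

section Tensor

variable {ι β : Type*} [Fintype ι]

/-- The tensor product of the matrices `G i`. -/
def tensorOp (G : ι → Matrix β β ℂ) : Matrix (ι → β) (ι → β) ℂ :=
  Matrix.of fun a b => ∏ i, G i (a i) (b i)

/-- Distributivity: a product of sums over the factors is a sum over all functions `ι → β`. -/
theorem tensorOp_mul [DecidableEq ι] [Fintype β] (G H : ι → Matrix β β ℂ) :
    tensorOp G * tensorOp H = tensorOp (G * H) := by
  ext a b
  simp only [tensorOp, Matrix.mul_apply, Matrix.of_apply, Pi.mul_apply, ← Finset.prod_mul_distrib,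
    Fintype.prod_sum]

theorem tensorOp_one [DecidableEq β] : tensorOp (1 : ι → Matrix β β ℂ) = 1 := by
  ext a b
  simp only [tensorOp, Matrix.of_apply, Pi.one_apply, Matrix.one_apply, Finset.prod_ite_zero,
    Finset.prod_const_one, funext_iff, Finset.mem_univ, true_imp_iff]

theorem conjTranspose_tensorOp (G : ι → Matrix β β ℂ) :
    (tensorOp G)ᴴ = tensorOp (star G) := by
  ext a b
  simp [tensorOp, Matrix.conjTranspose_apply, Matrix.star_apply]

theorem tensorOp_mem_unitaryGroup [DecidableEq ι] [Fintype β] [DecidableEq β] {G : ι → Matrix β β ℂ}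
    (hG : ∀ i, G i ∈ Matrix.unitaryGroup β ℂ) :
    tensorOp G ∈ Matrix.unitaryGroup (ι → β) ℂ := by
  rw [Matrix.mem_unitaryGroup_iff, Matrix.star_eq_conjTranspose, conjTranspose_tensorOp,
    tensorOp_mul, ← tensorOp_one]
  congr 1
  funext i
  exact Matrix.mem_unitaryGroup_iff.1 (hG i)

/-- The matrix `G` on the factor `i`, the identity on the other factors. -/
def siteOp [DecidableEq ι] [DecidableEq β] (i : ι) (G : Matrix β β ℂ) : Matrix (ι → β) (ι → β) ℂ :=
  tensorOp (Function.update 1 i G)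

theorem siteOp_apply [DecidableEq ι] [DecidableEq β] (i : ι) (G : Matrix β β ℂ) (a b : ι → β) :
    siteOp i G a b = if ∀ j, j ≠ i → a j = b j then G (a i) (b i) else 0 := by
  have h : siteOp i G a b = (∏ j ∈ Finset.univ.erase i, if a j = b j then (1 : ℂ) else 0)
      * G (a i) (b i) := by
    rw [siteOp, tensorOp, Matrix.of_apply, ← Finset.prod_erase_mul _ _ (Finset.mem_univ i),
      Function.update_self]
    congr 1
    refine Finset.prod_congr rfl fun j hj => ?_
    rw [Function.update_of_ne (Finset.ne_of_mem_erase hj), Pi.one_apply, Matrix.one_apply]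
  rw [h, Finset.prod_ite_zero, Finset.prod_const_one]
  simp

theorem siteOp_mem_unitaryGroup [DecidableEq ι] [Fintype β] [DecidableEq β] (i : ι)
    {G : Matrix β β ℂ} (hG : G ∈ Matrix.unitaryGroup β ℂ) :
    siteOp i G ∈ Matrix.unitaryGroup (ι → β) ℂ := by
  refine tensorOp_mem_unitaryGroup fun j => ?_
  rcases eq_or_ne j i with rfl | h
  · rwa [Function.update_self]
  · rw [Function.update_of_ne h]
    exact one_mem _

/-- The operator that applies `G` to the factors of a list, the head of the list first. -/
theorem foldr_siteOp [DecidableEq ι] [Fintype β] [DecidableEq β] (G : Matrix β β ℂ)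
    (l : List ι) (hl : l.Nodup) :
    l.foldr (fun i A => A * siteOp i G) 1 = tensorOp fun i => if i ∈ l then G else 1 := by
  induction l with
  | nil =>
    simp only [List.foldr_nil, List.not_mem_nil, if_false]
    exact tensorOp_one.symm
  | cons i l ih =>
    -- A repeated index would put a power of `G` on its factor.
    rw [List.nodup_cons] at hl
    rw [List.foldr_cons, ih hl.2, siteOp, tensorOp_mul]
    congr 1
    funext j
    rcases eq_or_ne j i with rfl | h
    · simp [hl.1]
    · simp [h]

end Tensor

/-! ### Operators of circuits -/

section Circuit

variable {n d k : ℕ}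

theorem eval_append (U : (Fin d → Fin (2 ^ k)) → Matrix (System n) (System n) ℂ)
    (C D : List (Gate d k)) : eval U (C ++ D) = eval U D * eval U C := by
  induction C with
  | nil => simp [eval]
  | cons g C ih => rw [List.cons_append, eval, ih, eval, mul_assoc]

theorem eval_mem_unitaryGroup {U : (Fin d → Fin (2 ^ k)) → Matrix (System n) (System n) ℂ}
    {C : List (Gate d k)}
    (h : ∀ g ∈ C, g.toMatrix U ∈ Matrix.unitaryGroup (Answer d k × System n) ℂ) :
    eval U C ∈ Matrix.unitaryGroup (Answer d k × System n) ℂ := by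
  induction C with
  | nil => exact one_mem _
  | cons g C ih =>
    exact mul_mem (ih fun g hg => h g (List.mem_cons_of_mem _ hg)) (h g List.mem_cons_self)

/-- Gates acting on the answer register alone compose there. The fold multiplies earlier gates on
the right, as `eval` does. -/
theorem eval_map_eq_kronecker {ι : Type*}
    (U : (Fin d → Fin (2 ^ k)) → Matrix (System n) (System n) ℂ)
    (G : ι → Gate d k) (A : ι → Matrix (Answer d k) (Answer d k) ℂ)
    (h : ∀ i, (G i).toMatrix U = A i ⊗ₖ (1 : Matrix (System n) (System n) ℂ)) (l : List ι) :
    eval U (l.map G) = (l.foldr (fun i B => B * A i) 1) ⊗ₖ (1 : Matrix (System n) (System n) ℂ) := by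
  induction l with
  | nil => simp [eval]
  | cons i l ih =>
    rw [List.map_cons, eval, ih, h, ← Matrix.mul_kronecker_mul, mul_one, List.foldr_cons]

/-- A single list of qubits without repetition is the form that `foldr_siteOp` needs. -/
theorem hadamards_eq :
    ((List.finRange d).flatMap fun i => (List.finRange k).map fun q => Gate.hadamard (i, q)) =
      ((List.finRange d ×ˢ List.finRange k).map Gate.hadamard) := by
  simp [List.product, SProd.sprod, List.map_flatMap, Function.comp_def]

theorem queries_gradientCircuit : queries (gradientCircuit d k) = 1 := by
  rw [queries, gradientCircuit, hadamards_eq]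
  simp [Function.comp_def, Gate.queries]

/-- The integers written in the blocks determine the bit string. -/
def valueEquiv (d k : ℕ) : Answer d k ≃ (Fin d → Fin (2 ^ k)) :=
  (Equiv.curry (Fin d) (Fin k) (Fin 2)).trans (Equiv.arrowCongr (Equiv.refl _) finFunctionFinEquiv)

theorem valueEquiv_apply (a : Answer d k) : valueEquiv d k a = a.value := rfl

theorem value_eq_iff (a b : Answer d k) (i : Fin d) :
    a.value i = b.value i ↔ ∀ q, a (i, q) = b (i, q) := by
  rw [Answer.value, Answer.value, finFunctionFinEquiv.injective.eq_iff, funext_iff]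

/-- The inverse quantum Fourier transform on a register with `M` basis states. -/
def invQFT (M : ℕ) : Matrix (Fin M) (Fin M) ℂ :=
  Matrix.of fun j l => ((1 / Real.sqrt M : ℝ) : ℂ) *
    Complex.exp (-(2 * Real.pi * Complex.I * ((j : ℕ) : ℂ) * ((l : ℕ) : ℂ) / M))

/-- The answer register has two tensor structures: `d * k` qubits for the Hadamards, and `d` factors
of dimension `2 ^ k` for the Fourier transforms. Passing to the second one makes the block transform
a one-site operator. -/
theorem invQFTOn_eq (i : Fin d) :
    (invQFTOn i : Matrix (Answer d k) (Answer d k) ℂ) =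
      (siteOp i (invQFT (2 ^ k))).submatrix (valueEquiv d k) (valueEquiv d k) := by
  ext a b
  rw [Matrix.submatrix_apply, siteOp_apply, invQFTOn, Matrix.of_apply]
  simp only [valueEquiv_apply, value_eq_iff]
  have : (∀ v : Fin d × Fin k, v.1 ≠ i → a v = b v) ↔ ∀ j, j ≠ i → ∀ q, a (j, q) = b (j, q) :=
    ⟨fun h j hj q => h (j, q) hj, fun h v hv => h v.1 hv v.2⟩
  simp only [this, invQFT, Matrix.of_apply]
  push_cast
  rfl

theorem hadamardOn_eq (w : Fin d × Fin k) :
    (hadamardOn w : Matrix (Answer d k) (Answer d k) ℂ) = siteOp w hadamardMatrix := by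
  ext a b
  rw [siteOp_apply, hadamardOn, Matrix.of_apply]

theorem hadamardMatrix_mem_unitaryGroup : hadamardMatrix ∈ Matrix.unitaryGroup (Fin 2) ℂ := by
  have h : ((Real.sqrt 2 : ℝ) : ℂ)⁻¹ * ((Real.sqrt 2 : ℝ) : ℂ)⁻¹ = 1 / 2 := by
    rw [← mul_inv, ← Complex.ofReal_mul, Real.mul_self_sqrt (by norm_num)]
    norm_num
  rw [Matrix.mem_unitaryGroup_iff]
  ext i j
  fin_cases i <;> fin_cases j <;>
    simp [hadamardMatrix, Matrix.mul_apply, Fin.sum_univ_two, Matrix.star_apply, h] <;> norm_num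

theorem submatrix_mem_unitaryGroup {α β : Type*} [Fintype α] [DecidableEq α] [Fintype β]
    [DecidableEq β] (e : α ≃ β) {A : Matrix β β ℂ} (hA : A ∈ Matrix.unitaryGroup β ℂ) :
    A.submatrix e e ∈ Matrix.unitaryGroup α ℂ := by
  rw [Matrix.mem_unitaryGroup_iff, Matrix.star_eq_conjTranspose] at *
  rw [Matrix.conjTranspose_submatrix, Matrix.submatrix_mul_equiv, hA, Matrix.submatrix_one_equiv]

theorem foldr_invQFTOn (l : List (Fin d)) :
    l.foldr (fun i B => B * (invQFTOn i : Matrix (Answer d k) (Answer d k) ℂ)) 1 =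
      (l.foldr (fun i A => A * siteOp i (invQFT (2 ^ k))) 1).submatrix
        (valueEquiv d k) (valueEquiv d k) := by
  induction l with
  | nil => simp
  | cons i l ih => rw [List.foldr_cons, List.foldr_cons, ih, invQFTOn_eq, Matrix.submatrix_mul_equiv]

/-- The matrix is block diagonal with blocks `U a.value`. -/
theorem controlled_mem_unitaryGroup
    {U : (Fin d → Fin (2 ^ k)) → Matrix (System n) (System n) ℂ}
    (hU : ∀ ε, U ε ∈ Matrix.unitaryGroup (System n) ℂ) :
    controlled U ∈ Matrix.unitaryGroup (Answer d k × System n) ℂ := by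
  rw [Matrix.mem_unitaryGroup_iff]
  ext ⟨a, s⟩ ⟨b, t⟩
  have h := congrFun (congrFun (Matrix.mem_unitaryGroup_iff.1 (hU a.value)) s) t
  rw [Matrix.mul_apply, Fintype.sum_prod_type, Finset.sum_eq_single a]
  · rw [Matrix.mul_apply] at h
    by_cases hab : a = b
    · subst hab
      simpa [controlled, Matrix.star_apply, Matrix.one_apply] using h
    · simp [controlled, Matrix.star_apply, hab, Ne.symm hab]
  · intro c _ hc
    simp [controlled, Ne.symm hc]
  · simp

/-! ### The output state -/

theorem hadamardMatrix_apply_zero (x : Fin 2) :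
    hadamardMatrix x 0 = ((1 / Real.sqrt 2 : ℝ) : ℂ) := by
  fin_cases x <;> simp [hadamardMatrix]

/-- Only the zero column of the Hadamard tensor power is used, and its entries are all equal. -/
theorem eval_hadamards_inputState (U : (Fin d → Fin (2 ^ k)) → Matrix (System n) (System n) ℂ)
    (Ψ : System n → ℂ) :
    eval U ((List.finRange d).flatMap fun i => (List.finRange k).map fun q => Gate.hadamard (i, q))
      *ᵥ inputState d k Ψ = fun p => ((1 / Real.sqrt 2 : ℝ) : ℂ) ^ (d * k) * Ψ p.2 := by
  have hmem : ∀ w : Fin d × Fin k, w ∈ List.finRange d ×ˢ List.finRange k := fun w =>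
    List.mem_product.2 ⟨List.mem_finRange _, List.mem_finRange _⟩
  have hnd : (List.finRange d ×ˢ List.finRange k).Nodup :=
    (List.nodup_finRange d).product (List.nodup_finRange k)
  rw [hadamards_eq, eval_map_eq_kronecker U Gate.hadamard (fun w => siteOp w hadamardMatrix)
    (fun w => by rw [Gate.toMatrix, hadamardOn_eq]), foldr_siteOp _ _ hnd]
  simp only [hmem, if_true]
  funext ⟨a, s⟩
  rw [Matrix.mulVec, dotProduct, Fintype.sum_prod_type, Finset.sum_eq_single 0]
  · simp [inputState, tensorOp, Matrix.one_apply, hadamardMatrix_apply_zero]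
  · intro b _ hb
    simp [inputState, hb]
  · simp

theorem outputState_apply (U : (Fin d → Fin (2 ^ k)) → Matrix (System n) (System n) ℂ)
    (Ψ : System n → ℂ) (a : Answer d k) (s : System n) :
    outputState U Ψ (a, s) = ∑ ε : Fin d → Fin (2 ^ k),
      ((1 / Real.sqrt 2 : ℝ) : ℂ) ^ (d * k) * (∏ i, invQFT (2 ^ k) (a.value i) (ε i))
        * (U ε *ᵥ Ψ) s := by
  have hc : controlled U *ᵥ (fun p : Answer d k × System n =>
      ((1 / Real.sqrt 2 : ℝ) : ℂ) ^ (d * k) * Ψ p.2) =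
      fun p => ((1 / Real.sqrt 2 : ℝ) : ℂ) ^ (d * k) * (U p.1.value *ᵥ Ψ) p.2 := by
    funext ⟨b, t⟩
    rw [Matrix.mulVec, dotProduct, Fintype.sum_prod_type, Finset.sum_eq_single b]
    · simp [controlled, Matrix.mulVec, dotProduct, Finset.mul_sum, mul_left_comm]
    · intro c _ hc
      simp [controlled, Ne.symm hc]
    · simp
  rw [outputState, gradientCircuit, eval_append, eval_append, ← Matrix.mulVec_mulVec,
    ← Matrix.mulVec_mulVec, eval_hadamards_inputState, eval, eval, one_mul, Gate.toMatrix, hc,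
    eval_map_eq_kronecker U Gate.invQFT (fun i => invQFTOn i) (fun i => rfl), foldr_invQFTOn,
    foldr_siteOp _ _ (List.nodup_finRange d), Matrix.mulVec, dotProduct, Fintype.sum_prod_type]
  simp only [List.mem_finRange, if_true]
  -- From here the control runs over tuples of integers instead of bit strings.
  rw [← (valueEquiv d k).sum_comp]
  refine Finset.sum_congr rfl fun b _ => ?_
  rw [Finset.sum_eq_single s]
  · simp only [Matrix.kroneckerMap_apply, Matrix.submatrix_apply, tensorOp, Matrix.of_apply,
      Matrix.one_apply_eq, mul_one, valueEquiv_apply]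
    ring
  · intro t _ ht
    simp [Ne.symm ht]
  · simp

end Circuit

/-! ### The Fourier transform of a plane wave -/

/-- The amplitude of phase estimation with `M` basis states at distance `δ` from the phase. -/
def dirichletMean (M : ℕ) (δ : ℝ) : ℂ :=
  (1 / M : ℂ) * ∑ l : Fin M, Complex.exp (-(2 * Real.pi * Complex.I * ((l : ℕ) : ℂ) * (δ : ℂ) / M))

theorem idealAmplitude_eq {d k : ℕ} (W : ℝ) (g : EuclideanSpace ℝ (Fin d)) (a : Answer d k) :
    idealAmplitude W g a =
      ∏ i, dirichletMean (2 ^ k) (((a.value i : ℕ) : ℝ) - 2 ^ k / W * g i) := by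
  simp [idealAmplitude, dirichletMean]

theorem dirichletMean_eq_geom_sum (M : ℕ) (δ : ℝ) :
    dirichletMean M δ = (1 / M : ℂ) *
      ∑ l ∈ Finset.range M, Complex.exp (Complex.I * ((-(2 * Real.pi * δ / M) : ℝ) : ℂ)) ^ l := by
  rw [dirichletMean, ← Fin.sum_univ_eq_sum_range
    (fun l => Complex.exp (Complex.I * ((-(2 * Real.pi * δ / M) : ℝ) : ℂ)) ^ l)]
  congr 1
  refine Finset.sum_congr rfl fun l _ => ?_
  rw [← Complex.exp_nat_mul]
  congr 1
  push_cast
  ring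

theorem dirichletMean_sub_int_mul {M : ℕ} (hM : M ≠ 0) (δ : ℝ) (z : ℤ) :
    dirichletMean M (δ - z * M) = dirichletMean M δ := by
  have hM' : (M : ℂ) ≠ 0 := Nat.cast_ne_zero.2 hM
  rw [dirichletMean_eq_geom_sum, dirichletMean_eq_geom_sum]
  have : Complex.exp (Complex.I * ((-(2 * Real.pi * (δ - z * M) / M) : ℝ) : ℂ)) =
      Complex.exp (Complex.I * ((-(2 * Real.pi * δ / M) : ℝ) : ℂ)) := by
    rw [Complex.exp_eq_exp_iff_exists_int]
    refine ⟨z, ?_⟩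
    push_cast
    field_simp
    ring
  rw [this]

theorem dirichletMean_zero {M : ℕ} (hM : M ≠ 0) : dirichletMean M 0 = 1 := by
  have hM' : (M : ℂ) ≠ 0 := Nat.cast_ne_zero.2 hM
  simp [dirichletMean, hM']

/-- Take norms in `(ζ - 1) ∑ ζ ^ l = ζ ^ M - 1`, using `|exp (iθ) - 1| = 2 |sin (θ / 2)|`. The
product form stays valid where the sine on the left vanishes. -/
theorem norm_dirichletMean_mul {M : ℕ} (hM : M ≠ 0) (δ : ℝ) :
    ‖dirichletMean M δ‖ * (M * |Real.sin (Real.pi * δ / M)|) = |Real.sin (Real.pi * δ)| := by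
  have hM' : (M : ℝ) ≠ 0 := Nat.cast_ne_zero.2 hM
  have h := mul_geom_sum (Complex.exp (Complex.I * ((-(2 * Real.pi * δ / M) : ℝ) : ℂ))) M
  have h2 : Complex.exp (Complex.I * ((-(2 * Real.pi * δ / M) : ℝ) : ℂ)) ^ M =
      Complex.exp (Complex.I * ((-(2 * Real.pi * δ) : ℝ) : ℂ)) := by
    rw [← Complex.exp_nat_mul]
    congr 1
    have : (M : ℂ) ≠ 0 := Nat.cast_ne_zero.2 hM
    push_cast
    field_simp
  rw [h2] at h
  have h3 := congrArg norm h
  rw [norm_mul, Complex.norm_exp_I_mul_ofReal_sub_one, Complex.norm_exp_I_mul_ofReal_sub_one] at h3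
  have e1 : -(2 * Real.pi * δ / M) / 2 = -(Real.pi * δ / M) := by ring
  have e2 : -(2 * Real.pi * δ) / 2 = -(Real.pi * δ) := by ring
  rw [e1, e2, Real.sin_neg, Real.sin_neg, mul_neg, mul_neg, norm_neg, norm_neg, norm_mul, norm_mul,
    Real.norm_eq_abs, Real.norm_eq_abs, Real.norm_eq_abs, abs_two] at h3
  rw [dirichletMean_eq_geom_sum, norm_mul, norm_div, norm_one, Complex.norm_natCast]
  field_simp
  linarith

/-- Jordan's inequality `|sin x| ≥ 2 |x| / π` bounds the denominator below, and the numerator is at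
most one. -/
theorem norm_dirichletMean_le {M : ℕ} (hM : M ≠ 0) {δ : ℝ} (h0 : δ ≠ 0) (hδ : |δ| ≤ M / 2) :
    ‖dirichletMean M δ‖ ≤ 1 / (2 * |δ|) := by
  have hMp : (0 : ℝ) < M := Nat.cast_pos.2 (Nat.pos_of_ne_zero hM)
  have hδ0 : 0 < |δ| := abs_pos.2 h0
  have hab : |Real.pi * δ / M| = Real.pi * |δ| / M := by
    rw [abs_div, abs_mul, abs_of_pos Real.pi_pos, abs_of_pos hMp]
  have h1 : 2 / Real.pi * (Real.pi * |δ| / M) ≤ |Real.sin (Real.pi * δ / M)| := by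
    rw [← hab]
    refine Real.mul_abs_le_abs_sin ?_
    rw [hab, div_le_iff₀ hMp]
    nlinarith [Real.pi_pos]
  have h2 : 2 * |δ| ≤ M * |Real.sin (Real.pi * δ / M)| := by
    have : 2 / Real.pi * (Real.pi * |δ| / M) = 2 * |δ| / M := by
      field_simp
    rw [this, div_le_iff₀ hMp] at h1
    linarith
  rw [le_div_iff₀ (by positivity)]
  calc ‖dirichletMean M δ‖ * (2 * |δ|)
      ≤ ‖dirichletMean M δ‖ * (M * |Real.sin (Real.pi * δ / M)|) := by gcongr
    _ ≤ 1 := by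
      rw [norm_dirichletMean_mul hM]
      exact Real.abs_sin_le_one _

/-- Here Jordan's inequality serves the numerator, and `|sin x| ≤ |x|` the denominator. -/
theorem le_norm_dirichletMean {M : ℕ} (hM : M ≠ 0) {δ : ℝ} (hδ : |δ| ≤ 1 / 2) :
    2 / Real.pi ≤ ‖dirichletMean M δ‖ := by
  rcases eq_or_ne δ 0 with rfl | h0
  · rw [dirichletMean_zero hM, norm_one, div_le_one Real.pi_pos]
    exact Real.two_le_pi
  have hMp : (0 : ℝ) < M := Nat.cast_pos.2 (Nat.pos_of_ne_zero hM)
  have hδ0 : 0 < |δ| := abs_pos.2 h0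
  have hab : |Real.pi * δ| = Real.pi * |δ| := by
    rw [abs_mul, abs_of_pos Real.pi_pos]
  have h1 : 2 / Real.pi * (Real.pi * |δ|) ≤ |Real.sin (Real.pi * δ)| := by
    rw [← hab]
    refine Real.mul_abs_le_abs_sin ?_
    rw [hab]
    nlinarith [Real.pi_pos]
  have h2 : M * |Real.sin (Real.pi * δ / M)| ≤ Real.pi * |δ| := by
    calc M * |Real.sin (Real.pi * δ / M)| ≤ M * |Real.pi * δ / M| :=
          mul_le_mul_of_nonneg_left Real.abs_sin_le_abs hMp.le
      _ = Real.pi * |δ| := by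
          rw [abs_div, hab, abs_of_pos hMp]
          field_simp
  have h3 : 2 / Real.pi * (Real.pi * |δ|) ≤ ‖dirichletMean M δ‖ * (Real.pi * |δ|) := by
    refine h1.trans ?_
    rw [← norm_dirichletMean_mul hM]
    gcongr
  exact le_of_mul_le_mul_right h3 (by positivity)

/-! ### Normalization -/

/-- The Gram entries are Dirichlet means at integers `j - j'`. There `sin (π (j - j'))` vanishes,
while `sin (π (j - j') / M)` vanishes only if `M` divides `j - j'`, that is if `j = j'`. -/
theorem invQFT_mem_unitaryGroup {M : ℕ} (hM : M ≠ 0) :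
    invQFT M ∈ Matrix.unitaryGroup (Fin M) ℂ := by
  have hMp : (0 : ℝ) < M := Nat.cast_pos.2 (Nat.pos_of_ne_zero hM)
  have hs : ((1 / Real.sqrt M : ℝ) : ℂ) * ((1 / Real.sqrt M : ℝ) : ℂ) = 1 / M := by
    rw [← Complex.ofReal_mul, div_mul_div_comm, Real.mul_self_sqrt hMp.le]
    push_cast
    ring
  rw [Matrix.mem_unitaryGroup_iff]
  ext j j'
  have key : (invQFT M * star (invQFT M)) j j' =
      dirichletMean M (((j : ℕ) : ℝ) - ((j' : ℕ) : ℝ)) := by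
    rw [Matrix.mul_apply, dirichletMean, Finset.mul_sum]
    refine Finset.sum_congr rfl fun l _ => ?_
    rw [Matrix.star_apply, invQFT, Matrix.of_apply, Matrix.of_apply, star_mul', Complex.star_def,
      Complex.conj_ofReal, ← Complex.exp_conj, mul_mul_mul_comm, hs,
      ← Complex.exp_add]
    congr 2
    simp only [map_neg, map_div₀, map_mul, Complex.conj_I, Complex.conj_ofReal, Complex.conj_natCast,
      map_ofNat]
    push_cast
    ring
  rw [key]
  rcases eq_or_ne j j' with rfl | h
  · rw [sub_self, dirichletMean_zero hM, Matrix.one_apply_eq]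
  rw [Matrix.one_apply_ne h, ← norm_eq_zero]
  have h1 := norm_dirichletMean_mul hM (((j : ℕ) : ℝ) - ((j' : ℕ) : ℝ))
  have h2 : Real.sin (Real.pi * (((j : ℕ) : ℝ) - ((j' : ℕ) : ℝ))) = 0 :=
    Real.sin_eq_zero_iff.2 ⟨(j : ℤ) - (j' : ℤ), by push_cast; ring⟩
  rw [h2, abs_zero] at h1
  refine (mul_eq_zero.1 h1).resolve_right (mul_ne_zero hMp.ne' (abs_ne_zero.2 fun h0 => ?_))
  obtain ⟨m, hm⟩ := Real.sin_eq_zero_iff.1 h0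
  have hm' : (m : ℝ) * M = ((j : ℕ) : ℝ) - ((j' : ℕ) : ℝ) := by
    have := Real.pi_ne_zero
    field_simp at hm
    linarith
  have hm2 : m * (M : ℤ) = (j : ℕ) - ((j' : ℕ) : ℤ) := by exact_mod_cast hm'
  have hj := j.isLt
  have hj' := j'.isLt
  apply h
  have hdvd : (M : ℤ) ∣ (j : ℕ) - ((j' : ℕ) : ℤ) := ⟨m, by rw [← hm2]; ring⟩
  have := Int.eq_zero_of_abs_lt_dvd hdvd (by rw [abs_lt]; omega)
  exact Fin.ext (by omega)

/-- The Euclidean norm is written as a sum because the norm of the function type is the supremum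
norm. -/
theorem sum_norm_sq_mulVec {α : Type*} [Fintype α] [DecidableEq α] {A : Matrix α α ℂ}
    (hA : A ∈ Matrix.unitaryGroup α ℂ) (v : α → ℂ) :
    ∑ i, ‖(A *ᵥ v) i‖ ^ 2 = ∑ i, ‖v i‖ ^ 2 := by
  have h : ∀ w : α → ℂ, ((∑ i, ‖w i‖ ^ 2 : ℝ) : ℂ) = star w ⬝ᵥ w := by
    intro w
    push_cast
    refine Finset.sum_congr rfl fun i _ => ?_
    rw [Pi.star_apply, Complex.star_def, Complex.conj_mul']
  have : ((∑ i, ‖(A *ᵥ v) i‖ ^ 2 : ℝ) : ℂ) = ((∑ i, ‖v i‖ ^ 2 : ℝ) : ℂ) := by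
    rw [h, h, Matrix.star_mulVec, Matrix.dotProduct_mulVec, Matrix.vecMul_vecMul,
      ← Matrix.star_eq_conjTranspose, Matrix.mem_unitaryGroup_iff'.1 hA, Matrix.vecMul_one]
  exact_mod_cast this

/-- Parseval: these amplitudes are the inverse Fourier transform of a normalized plane wave of
arbitrary real frequency `x`. -/
theorem sum_norm_sq_dirichletMean {M : ℕ} (hM : M ≠ 0) (x : ℝ) :
    ∑ j : Fin M, ‖dirichletMean M (((j : ℕ) : ℝ) - x)‖ ^ 2 = 1 := by
  have hMp : (0 : ℝ) < M := Nat.cast_pos.2 (Nat.pos_of_ne_zero hM)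
  have hs : ((1 / Real.sqrt M : ℝ) : ℂ) * ((1 / Real.sqrt M : ℝ) : ℂ) = 1 / M := by
    rw [← Complex.ofReal_mul, div_mul_div_comm, Real.mul_self_sqrt hMp.le]
    push_cast
    ring
  have key : ∀ j : Fin M, dirichletMean M (((j : ℕ) : ℝ) - x) = (invQFT M *ᵥ fun l : Fin M =>
      ((1 / Real.sqrt M : ℝ) : ℂ) *
        Complex.exp (((2 * Real.pi * l * x / M : ℝ) : ℂ) * Complex.I)) j := by
    intro j
    rw [dirichletMean, Matrix.mulVec, dotProduct, Finset.mul_sum]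
    refine Finset.sum_congr rfl fun l _ => ?_
    rw [invQFT, Matrix.of_apply, mul_mul_mul_comm, hs, ← Complex.exp_add]
    congr 2
    push_cast
    ring
  simp_rw [key]
  rw [sum_norm_sq_mulVec (invQFT_mem_unitaryGroup hM)]
  simp only [norm_mul, Complex.norm_exp_ofReal_mul_I, mul_one, Complex.norm_real, Real.norm_eq_abs,
    sq_abs, Finset.sum_const, Finset.card_univ, Fintype.card_fin, nsmul_eq_mul, div_pow, one_pow,
    Real.sq_sqrt hMp.le]
  field_simp

/-! ### The tail of the distribution -/

theorem sum_one_div_sq_le {r : ℝ} (hr : 1 < r) (K : ℕ) :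
    ∑ m ∈ Finset.range K, 1 / (r + m) ^ 2 ≤ 1 / (r - 1) - 1 / (r - 1 + K) := by
  induction K with
  | zero => simp
  | succ K ih =>
    rw [Finset.sum_range_succ]
    have hK : (0 : ℝ) ≤ K := K.cast_nonneg
    have h1 : 0 < r - 1 + K := by linarith
    -- Telescoping: the right-hand side equals `1 / ((r - 1 + K) * (r + K))`.
    have : 1 / (r + K) ^ 2 ≤ 1 / (r - 1 + K) - 1 / (r - 1 + (K + 1 : ℕ)) := by
      have e : r - 1 + (K + 1 : ℕ) = r + K := by push_cast; ring
      have h2 : 0 < r + K := by linarith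
      rw [e, div_sub_div _ _ h1.ne' h2.ne', div_le_div_iff₀ (by positivity) (by positivity)]
      nlinarith [mul_pos h2 h1, mul_pos h2 h2]
    linarith

/-- Counting the integers from `⌈x + r⌉` upwards, the one with index `l` lies at distance at least
`r + l` from `x`. -/
theorem sum_int_one_div_sq_le {r : ℝ} (hr : 1 < r) (x : ℝ) (S : Finset ℤ)
    (hS : ∀ m ∈ S, r < m - x) : ∑ m ∈ S, 1 / ((m : ℝ) - x) ^ 2 ≤ 1 / (r - 1) := by
  have hle : ∀ m ∈ S, ⌈x + r⌉ ≤ m := fun m hm => Int.ceil_le.2 (by linarith [hS m hm])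
  have hinj : Set.InjOn (fun m : ℤ => (m - ⌈x + r⌉).toNat) S := by
    intro a ha b hb hab
    have := hle a ha
    have := hle b hb
    simp only at hab
    omega
  obtain ⟨K, hK⟩ := (S.image fun m : ℤ => (m - ⌈x + r⌉).toNat).exists_nat_subset_range
  calc ∑ m ∈ S, 1 / ((m : ℝ) - x) ^ 2
      ≤ ∑ m ∈ S, 1 / (r + ((m - ⌈x + r⌉).toNat : ℕ)) ^ 2 := by
        refine Finset.sum_le_sum fun m hm => ?_
        have h1 : (((m - ⌈x + r⌉).toNat : ℕ) : ℝ) = m - ⌈x + r⌉ := by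
          have : (((m - ⌈x + r⌉).toNat : ℕ) : ℤ) = m - ⌈x + r⌉ :=
            Int.toNat_of_nonneg (by linarith [hle m hm])
          exact_mod_cast this
        have h2 : r + ((m - ⌈x + r⌉).toNat : ℕ) ≤ m - x := by
          rw [h1]
          linarith [Int.le_ceil (x + r)]
        have h3 : (0 : ℝ) ≤ ((m - ⌈x + r⌉).toNat : ℕ) := Nat.cast_nonneg _
        have h4 : 0 < r + ((m - ⌈x + r⌉).toNat : ℕ) := by linarith
        gcongr
    _ = ∑ l ∈ S.image fun m : ℤ => (m - ⌈x + r⌉).toNat, 1 / (r + (l : ℝ)) ^ 2 :=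
        (Finset.sum_image (f := fun l : ℕ => 1 / (r + (l : ℝ)) ^ 2) hinj).symm
    _ ≤ ∑ l ∈ Finset.range K, 1 / (r + (l : ℝ)) ^ 2 :=
        Finset.sum_le_sum_of_subset_of_nonneg hK fun _ _ _ => by positivity
    _ ≤ 1 / (r - 1) := by
        have : 0 ≤ 1 / (r - 1 + K) :=
          div_nonneg zero_le_one (by linarith [(K.cast_nonneg : (0 : ℝ) ≤ K)])
        linarith [sum_one_div_sq_le hr K]

theorem sum_int_abs_one_div_sq_le {r : ℝ} (hr : 1 < r) (x : ℝ) (S : Finset ℤ)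
    (hS : ∀ m ∈ S, r < |(m : ℝ) - x|) : ∑ m ∈ S, 1 / ((m : ℝ) - x) ^ 2 ≤ 2 / (r - 1) := by
  have h1 := sum_int_one_div_sq_le hr x (S.filter fun m : ℤ => x < m) (by
    intro m hm
    rw [Finset.mem_filter] at hm
    have := hS m hm.1
    rwa [abs_of_pos (by linarith)] at this)
  -- The integers to the left of `x` are reflected to the right of `-x`.
  have h2 := sum_int_one_div_sq_le hr (-x) ((S.filter fun m : ℤ => ¬ x < m).map
    (Equiv.neg ℤ).toEmbedding) (by
    intro m hm
    rw [Finset.mem_map_equiv, Finset.mem_filter] at hm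
    have h3 := hS _ hm.1
    have h4 := hm.2
    simp only [Equiv.neg_symm, Equiv.neg_apply, Int.cast_neg] at h3 h4
    rw [abs_of_nonpos (by linarith)] at h3
    linarith)
  rw [Finset.sum_map] at h2
  have h3 : ∀ m : ℤ, 1 / ((((Equiv.neg ℤ).toEmbedding m : ℤ) : ℝ) - -x) ^ 2 =
      1 / ((m : ℝ) - x) ^ 2 := by
    intro m
    congr 1
    simp only [Equiv.coe_toEmbedding, Equiv.neg_apply, Int.cast_neg]
    ring
  simp only [h3] at h2
  rw [← Finset.sum_filter_add_sum_filter_not S (fun m : ℤ => x < m)]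
  have : 2 / (r - 1) = 1 / (r - 1) + 1 / (r - 1) := by ring
  linarith

/-- Modulo `M` each outcome can be moved to within `M / 2` of `x`, where its probability is at most
`1 / (4 δ ^ 2)`. Summing over both sides gives `1 / 4 * (2 / (r - 1))`. -/
theorem sum_norm_sq_dirichletMean_tail {M : ℕ} (hM : M ≠ 0) {r : ℝ} (hr : 1 < r) (x : ℝ)
    (S : Finset (Fin M)) (hS : ∀ j ∈ S, ∀ z : ℤ, r < |((j : ℕ) : ℝ) - x - z * M|) :
    ∑ j ∈ S, ‖dirichletMean M (((j : ℕ) : ℝ) - x)‖ ^ 2 ≤ 1 / (2 * (r - 1)) := by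
  have hMp : (0 : ℝ) < M := Nat.cast_pos.2 (Nat.pos_of_ne_zero hM)
  -- `N j` is a representative of `j` modulo `M` nearest to `x`; distinct residues have distinct
  -- representatives.
  set N : Fin M → ℤ := fun j => ((j : ℕ) : ℤ) - round ((((j : ℕ) : ℝ) - x) / M) * M with hN
  have hNx : ∀ j : Fin M, (N j : ℝ) - x =
      ((j : ℕ) : ℝ) - x - (round ((((j : ℕ) : ℝ) - x) / M) : ℤ) * M := by
    intro j
    simp only [hN]
    push_cast
    ring
  have hinj : Function.Injective N := by
    intro a b hab
    have ha := a.isLt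
    have hb := b.isLt
    have hdvd : (M : ℤ) ∣ ((a : ℕ) : ℤ) - ((b : ℕ) : ℤ) :=
      ⟨round ((((a : ℕ) : ℝ) - x) / M) - round ((((b : ℕ) : ℝ) - x) / M), by
        simp only [hN] at hab
        linarith⟩
    have := Int.eq_zero_of_abs_lt_dvd hdvd (by rw [abs_lt]; omega)
    exact Fin.ext (by omega)
  have hterm : ∀ j ∈ S, ‖dirichletMean M (((j : ℕ) : ℝ) - x)‖ ^ 2 ≤
      1 / 4 * (1 / ((N j : ℝ) - x) ^ 2) := by
    intro j hj
    have h1 : r < |(N j : ℝ) - x| := by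
      rw [hNx]
      exact hS j hj _
    have h2 : |(N j : ℝ) - x| ≤ M / 2 := by
      have h3 := abs_sub_round ((((j : ℕ) : ℝ) - x) / M)
      have h4 : (N j : ℝ) - x = ((((j : ℕ) : ℝ) - x) / M - round ((((j : ℕ) : ℝ) - x) / M)) * M := by
        rw [hNx]
        field_simp
      rw [h4, abs_mul, abs_of_pos hMp]
      nlinarith
    have h0 : (N j : ℝ) - x ≠ 0 := abs_pos.1 (by linarith)
    rw [← dirichletMean_sub_int_mul hM _ (round ((((j : ℕ) : ℝ) - x) / M)), ← hNx]
    calc ‖dirichletMean M ((N j : ℝ) - x)‖ ^ 2 ≤ (1 / (2 * |(N j : ℝ) - x|)) ^ 2 := by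
          gcongr
          exact norm_dirichletMean_le hM h0 h2
      _ = 1 / 4 * (1 / ((N j : ℝ) - x) ^ 2) := by
          rw [div_pow, mul_pow, sq_abs, one_pow]
          field_simp
          norm_num
  have hsum := sum_int_abs_one_div_sq_le hr x (S.map ⟨N, hinj⟩) (by
    intro m hm
    obtain ⟨j, hj, rfl⟩ := Finset.mem_map.1 hm
    rw [Function.Embedding.coeFn_mk, hNx]
    exact hS j hj _)
  rw [Finset.sum_map] at hsum
  simp only [Function.Embedding.coeFn_mk] at hsum
  refine (Finset.sum_le_sum hterm).trans ?_
  rw [← Finset.mul_sum]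
  have : 1 / (2 * (r - 1)) = 1 / 4 * (2 / (r - 1)) := by
    have : r - 1 ≠ 0 := by linarith
    field_simp
    norm_num
  rw [this]
  gcongr

/-! ### The ideal distribution -/

section Ideal

variable {d k : ℕ} {W : ℝ} {g : EuclideanSpace ℝ (Fin d)}

theorem sum_norm_sq_idealAmplitude : ∑ a : Answer d k, ‖idealAmplitude W g a‖ ^ 2 = 1 := by
  have hM : (2 ^ k : ℕ) ≠ 0 := by positivity
  simp only [idealAmplitude_eq, norm_prod, ← Finset.prod_pow]
  rw [← Equiv.sum_comp (valueEquiv d k).symm]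
  simp only [← valueEquiv_apply, Equiv.apply_symm_apply]
  rw [← Fintype.prod_sum (fun i (j : Fin (2 ^ k)) =>
    ‖dirichletMean (2 ^ k) (((j : ℕ) : ℝ) - 2 ^ k / W * g i)‖ ^ 2)]
  simp [sum_norm_sq_dirichletMean hM]

-- The distribution is a product, so an event about component `i` has the probability of its
-- one-dimensional marginal.
open Classical in
theorem sum_norm_sq_idealAmplitude_filter_le {r : ℝ} (hr : 1 < r) (hW : 0 < W) (i : Fin d) :
    ∑ a : Answer d k with ∀ z : ℤ, r * W / 2 ^ k <
        |W * ((a.value i : ℕ) : ℝ) / 2 ^ k - g i - z * W|, ‖idealAmplitude W g a‖ ^ 2 ≤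
      1 / (2 * (r - 1)) := by
  have hM : (2 ^ k : ℕ) ≠ 0 := by positivity
  set p : Fin d → Fin (2 ^ k) → ℝ := fun i j =>
    ‖dirichletMean (2 ^ k) (((j : ℕ) : ℝ) - 2 ^ k / W * g i)‖ ^ 2 with hp
  set P : Fin (2 ^ k) → Prop := fun j =>
    ∀ z : ℤ, r * W / 2 ^ k < |W * ((j : ℕ) : ℝ) / 2 ^ k - g i - z * W| with hP
  -- The event is absorbed into the factor `i`, so that the sum factorizes; the other factors then
  -- sum to one.
  have h1 : ∑ a : Answer d k with P (a.value i), ‖idealAmplitude W g a‖ ^ 2 =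
      ∑ ε : Fin d → Fin (2 ^ k), ∏ l, (if l = i then (if P (ε l) then p l (ε l) else 0)
        else p l (ε l)) := by
    rw [Finset.sum_filter, ← Equiv.sum_comp (valueEquiv d k)]
    refine Finset.sum_congr rfl fun a _ => ?_
    simp only [valueEquiv_apply, idealAmplitude_eq, norm_prod, ← Finset.prod_pow]
    split_ifs with h
    · refine Finset.prod_congr rfl fun l _ => ?_
      by_cases hl : l = i
      · subst hl
        simp [h, hp]
      · simp [hl, hp]
    · symm
      exact Finset.prod_eq_zero (Finset.mem_univ i) (by simp [h])
  rw [h1, ← Fintype.prod_sum (fun l (j : Fin (2 ^ k)) =>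
    if l = i then (if P j then p l j else 0) else p l j),
    ← Finset.mul_prod_erase _ _ (Finset.mem_univ i), Finset.prod_eq_one, mul_one]
  · simp only [if_true]
    rw [← Finset.sum_filter]
    refine sum_norm_sq_dirichletMean_tail hM hr _ _ fun j hj z => ?_
    have h2 := (Finset.mem_filter.1 hj).2 z
    have e : W * ((j : ℕ) : ℝ) / 2 ^ k - g i - z * W =
        (((j : ℕ) : ℝ) - 2 ^ k / W * g i - z * (2 ^ k : ℕ)) * (W / 2 ^ k) := by
      push_cast
      field_simp
    rw [e, abs_mul, abs_of_pos (show (0 : ℝ) < W / 2 ^ k by positivity), mul_div_assoc] at h2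
    exact lt_of_mul_lt_mul_right h2 (by positivity)
  · intro l hl
    simp only [Finset.ne_of_mem_erase hl, if_false]
    exact sum_norm_sq_dirichletMean hM _

/-- Union bound: an inaccurate outcome has a component that is far from `g i` for every shift `z`.
-/
theorem one_sub_le_sum_norm_sq_idealAmplitude {r : ℝ} (hr : 1 < r) (hW : 0 < W) :
    1 - d / (2 * (r - 1)) ≤ ∑ a : Answer d k,
      (accurate W g (r * W / 2 ^ k)).indicator (fun a => ‖idealAmplitude W g a‖ ^ 2) a := by
  classical
  have h1 : ∀ a : Answer d k, ‖idealAmplitude W g a‖ ^ 2 ≤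
      (accurate W g (r * W / 2 ^ k)).indicator (fun a => ‖idealAmplitude W g a‖ ^ 2) a +
      ∑ i, if ∀ z : ℤ, r * W / 2 ^ k < |W * ((a.value i : ℕ) : ℝ) / 2 ^ k - g i - z * W| then
        ‖idealAmplitude W g a‖ ^ 2 else 0 := by
    intro a
    by_cases ha : a ∈ accurate W g (r * W / 2 ^ k)
    · rw [Set.indicator_of_mem ha]
      exact le_add_of_nonneg_right (Finset.sum_nonneg fun i _ => by positivity)
    · rw [Set.indicator_of_notMem ha, zero_add]
      simp only [accurate, Set.mem_ofPred_eq, not_forall, not_exists, not_le] at ha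
      obtain ⟨i, hi⟩ := ha
      refine le_trans ?_ (Finset.single_le_sum (fun j _ => by positivity) (Finset.mem_univ i))
      rw [if_pos hi]
  have h2 := Finset.sum_le_sum fun a (_ : a ∈ Finset.univ) => h1 a
  rw [sum_norm_sq_idealAmplitude, Finset.sum_add_distrib, Finset.sum_comm] at h2
  have h3 : ∑ i : Fin d, ∑ a : Answer d k,
      (if ∀ z : ℤ, r * W / 2 ^ k < |W * ((a.value i : ℕ) : ℝ) / 2 ^ k - g i - z * W| then
        ‖idealAmplitude W g a‖ ^ 2 else 0) ≤ ∑ _i : Fin d, 1 / (2 * (r - 1)) := by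
    refine Finset.sum_le_sum fun i _ => ?_
    rw [← Finset.sum_filter]
    exact sum_norm_sq_idealAmplitude_filter_le hr hW i
  rw [Finset.sum_const, Finset.card_univ, Fintype.card_fin, nsmul_eq_mul, mul_one_div] at h3
  linarith

theorem le_norm_sq_idealAmplitude (hW : 0 < W) {a : Answer d k}
    (ha : a ∈ accurate W g (W / (2 * 2 ^ k))) :
    (4 / Real.pi ^ 2) ^ d ≤ ‖idealAmplitude W g a‖ ^ 2 := by
  have hM : (2 ^ k : ℕ) ≠ 0 := by positivity
  have h : (4 / Real.pi ^ 2) ^ d = ∏ _i : Fin d, (2 / Real.pi) ^ 2 := by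
    rw [Finset.prod_const, Finset.card_univ, Fintype.card_fin]
    congr 1
    ring
  rw [idealAmplitude_eq, norm_prod, ← Finset.prod_pow, h]
  refine Finset.prod_le_prod (fun _ _ => by positivity) fun i _ => ?_
  obtain ⟨z, hz⟩ := ha i
  rw [← dirichletMean_sub_int_mul hM _ z]
  have e : W * ((a.value i : ℕ) : ℝ) / 2 ^ k - g i - z * W =
      (((a.value i : ℕ) : ℝ) - 2 ^ k / W * g i - z * (2 ^ k : ℕ)) * (W / 2 ^ k) := by
    push_cast
    field_simp
  rw [e, abs_mul, abs_of_pos (show (0 : ℝ) < W / 2 ^ k by positivity),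
    show W / (2 * 2 ^ k) = 1 / 2 * (W / 2 ^ k) by ring] at hz
  have := le_norm_dirichletMean hM (le_of_mul_le_mul_right hz (by positivity))
  gcongr

theorem norm_sq_idealAmplitude_eq_one (hW : 0 < W) {a : Answer d k} (ha : a ∈ accurate W g 0) :
    ‖idealAmplitude W g a‖ ^ 2 = 1 := by
  have hM : (2 ^ k : ℕ) ≠ 0 := by positivity
  rw [idealAmplitude_eq, Finset.prod_eq_one, norm_one, one_pow]
  intro i _
  obtain ⟨z, hz⟩ := ha i
  have hz' := abs_nonpos_iff.1 hz
  rw [← dirichletMean_sub_int_mul hM _ z, ← dirichletMean_zero hM]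
  congr 1
  push_cast
  have : ((a.value i : ℕ) : ℝ) - 2 ^ k / W * g i - z * 2 ^ k =
      (W * ((a.value i : ℕ) : ℝ) / 2 ^ k - g i - z * W) * (2 ^ k / W) := by
    field_simp
  rw [this, hz', zero_mul]

end Ideal

/-! ### Perturbation of a simple eigenvalue -/

section Perturbation

variable {n d : ℕ} {X : Matrix (System n) (System n) ℂ}
  {Δ : Fin d → Matrix (System n) (System n) ℂ} {lam : ℝ} {Ψ : System n → ℂ}

theorem star_dotProduct_self (hΨ : ∑ s, ‖Ψ s‖ ^ 2 = 1) : star Ψ ⬝ᵥ Ψ = 1 := by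
  have : star Ψ ⬝ᵥ Ψ = ((∑ s, ‖Ψ s‖ ^ 2 : ℝ) : ℂ) := by
    push_cast
    refine Finset.sum_congr rfl fun i _ => ?_
    rw [Pi.star_apply, Complex.star_def, Complex.conj_mul']
  rw [this, hΨ, Complex.ofReal_one]

theorem star_dotProduct_mulVec (hX : X.IsHermitian) (hXΨ : X *ᵥ Ψ = (lam : ℂ) • Ψ)
    (w : System n → ℂ) : star Ψ ⬝ᵥ X *ᵥ w = lam * (star Ψ ⬝ᵥ w) := by
  have h := congrArg star hXΨ
  rw [Matrix.star_mulVec, hX.eq, star_smul, Complex.star_def, Complex.conj_ofReal] at h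
  rw [Matrix.dotProduct_mulVec, h, smul_dotProduct, smul_eq_mul]

theorem perturbed_isHermitian (hX : X.IsHermitian) (hΔ : ∀ i, (Δ i).IsHermitian)
    (x : EuclideanSpace ℝ (Fin d)) : (perturbed X Δ x).IsHermitian := by
  unfold perturbed Matrix.IsHermitian
  rw [Matrix.conjTranspose_add, Matrix.conjTranspose_sum, hX.eq]
  congr 1
  refine Finset.sum_congr rfl fun i _ => ?_
  rw [Matrix.conjTranspose_smul, (hΔ i).eq, Complex.star_def, Complex.conj_ofReal]

/-- The implicit function theorem is run with a complex eigenvalue, to match the number of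
equations; this recovers that it is real. -/
theorem ofReal_re_of_mulVec_eq_smul {A : Matrix (System n) (System n) ℂ} (hA : A.IsHermitian)
    {v : System n → ℂ} (hv : v ≠ 0) {μ : ℂ} (h : A *ᵥ v = μ • v) : ((μ.re : ℝ) : ℂ) = μ := by
  have h1 : star v ⬝ᵥ A *ᵥ v = μ * (star v ⬝ᵥ v) := by rw [h, dotProduct_smul, smul_eq_mul]
  have h2 : star v ⬝ᵥ A *ᵥ v = star μ * (star v ⬝ᵥ v) := by
    rw [Matrix.dotProduct_mulVec, ← hA.eq, ← Matrix.star_mulVec, h, star_smul, smul_dotProduct,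
      smul_eq_mul]
  have h3 : star v ⬝ᵥ v ≠ 0 := by
    open scoped ComplexOrder in exact fun h => hv (dotProduct_star_self_eq_zero.1 h)
  have h4 : star μ = μ := mul_right_cancel₀ h3 (h2.symm.trans h1)
  exact Complex.conj_eq_iff_re.1 h4

/-- The eigenvalue equation of the perturbed matrix, with a normalization of the eigenvector. -/
def eigenEquation (X : Matrix (System n) (System n) ℂ) (Δ : Fin d → Matrix (System n) (System n) ℂ)
    (Ψ : System n → ℂ) (u : EuclideanSpace ℝ (Fin d) × ((System n → ℂ) × ℂ)) :
    (System n → ℂ) × ℂ :=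
  (perturbed X Δ u.1 *ᵥ u.2.1 - u.2.2 • u.2.1, star Ψ ⬝ᵥ u.2.1)

theorem contDiff_eigenEquation : ContDiff ℝ 1 (eigenEquation X Δ Ψ) := by
  unfold eigenEquation perturbed
  simp only [dotProduct]
  refine ContDiff.prodMk (contDiff_pi.2 fun s => ?_) ?_
  · simp only [Pi.sub_apply, Pi.smul_apply, smul_eq_mul, Matrix.mulVec, dotProduct,
      Matrix.add_apply, Matrix.sum_apply, Matrix.smul_apply]
    have : ∀ i : Fin d, ContDiff ℝ 1 fun u : EuclideanSpace ℝ (Fin d) × ((System n → ℂ) × ℂ) =>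
        ((u.1 i : ℝ) : ℂ) := fun i => Complex.ofRealCLM.contDiff.comp (by fun_prop)
    fun_prop
  · fun_prop

/-- The linearization of the eigenvalue equation in the eigenvector and the eigenvalue. -/
def eigenLinearization (X : Matrix (System n) (System n) ℂ) (lam : ℝ) (Ψ : System n → ℂ) :
    ((System n → ℂ) × ℂ) →ₗ[ℝ] ((System n → ℂ) × ℂ) where
  toFun y := (X *ᵥ y.1 - (lam : ℂ) • y.1 - y.2 • Ψ, star Ψ ⬝ᵥ y.1)
  map_add' y z := by
    refine Prod.ext ?_ ?_
    · simp only [Prod.fst_add, Prod.snd_add, Matrix.mulVec_add, smul_add, add_smul]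
      abel
    · simp [dotProduct_add]
  map_smul' c y := by
    refine Prod.ext ?_ ?_
    · simp only [Prod.smul_fst, Prod.smul_snd, Matrix.mulVec_smul, RingHom.id_apply, smul_sub,
        smul_assoc, smul_comm (lam : ℂ) c]
    · simp [dotProduct_smul]

/-- Pairing the first component with `Ψ` removes `X w - lam w`, since `X` is Hermitian, and leaves
`ν = 0`. Simplicity then makes `w` a multiple of `Ψ`, and the normalization makes it zero. -/
theorem eigenLinearization_injective (hX : X.IsHermitian) (hΨ : ∑ s, ‖Ψ s‖ ^ 2 = 1)
    (hXΨ : X *ᵥ Ψ = (lam : ℂ) • Ψ) (hs : ∀ v, X *ᵥ v = (lam : ℂ) • v → ∃ c : ℂ, v = c • Ψ) :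
    Function.Injective (eigenLinearization X lam Ψ) := by
  rw [injective_iff_map_eq_zero]
  rintro ⟨w, ν⟩ h
  obtain ⟨h1, h2⟩ := Prod.ext_iff.1 h
  simp only [eigenLinearization, LinearMap.coe_mk, AddHom.coe_mk, Prod.fst_zero,
    Prod.snd_zero] at h1 h2
  have h3 := congrArg (star Ψ ⬝ᵥ ·) h1
  simp only [dotProduct_sub, dotProduct_smul, star_dotProduct_mulVec hX hXΨ, h2,
    star_dotProduct_self hΨ, smul_eq_mul, dotProduct_zero, mul_zero, mul_one, zero_sub,
    neg_eq_zero, sub_zero] at h3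
  subst h3
  rw [zero_smul, sub_zero, sub_eq_zero] at h1
  obtain ⟨c, rfl⟩ := hs w h1
  rw [dotProduct_smul, star_dotProduct_self hΨ, smul_eq_mul, mul_one] at h2
  subst h2
  simp

theorem fderiv_eigenEquation_inr (y : (System n → ℂ) × ℂ) :
    fderiv ℝ (eigenEquation X Δ Ψ) (0, (Ψ, (lam : ℂ))) (0, y) = eigenLinearization X lam Ψ y := by
  have h1 : HasFDerivAt (eigenEquation X Δ Ψ) (fderiv ℝ (eigenEquation X Δ Ψ) (0, (Ψ, (lam : ℂ))))
      (0, (Ψ, (lam : ℂ))) :=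
    (contDiff_eigenEquation.differentiable one_ne_zero _).hasFDerivAt
  have hline : HasDerivAt (fun t : ℝ => (((0 : EuclideanSpace ℝ (Fin d)), (Ψ, (lam : ℂ))) +
      t • ((0 : EuclideanSpace ℝ (Fin d)), y))) (0, y) 0 := by
    simpa using ((hasDerivAt_id (0 : ℝ)).smul_const
      ((0 : EuclideanSpace ℝ (Fin d)), y)).const_add (0, (Ψ, (lam : ℂ)))
  have h2 := HasFDerivAt.comp_hasDerivAt (0 : ℝ) (by simpa using h1) hline
  -- Along this line the equation is exactly quadratic in `t`, so its derivative at zero is the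
  -- linear coefficient.
  have hform : (eigenEquation X Δ Ψ ∘ fun t : ℝ => (((0 : EuclideanSpace ℝ (Fin d)), (Ψ, (lam : ℂ))) +
      t • ((0 : EuclideanSpace ℝ (Fin d)), y))) = fun t : ℝ =>
      eigenEquation X Δ Ψ (0, (Ψ, (lam : ℂ))) + t • eigenLinearization X lam Ψ y +
        (t * t) • (-(y.2 • y.1), 0) := by
    funext t
    refine Prod.ext ?_ ?_
    · simp only [Function.comp_apply, eigenEquation, perturbed, eigenLinearization,
        LinearMap.coe_mk, AddHom.coe_mk, Prod.fst_add, Prod.snd_add, Prod.smul_fst, Prod.smul_snd,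
        smul_zero, add_zero, PiLp.zero_apply, Complex.ofReal_zero, zero_smul,
        Finset.sum_const_zero, Matrix.mulVec_add, Matrix.mulVec_smul]
      funext s
      simp only [Pi.add_apply, Pi.sub_apply, Pi.smul_apply, Pi.neg_apply, smul_eq_mul,
        Complex.real_smul]
      push_cast
      ring
    · simp [eigenEquation, eigenLinearization, dotProduct_add, dotProduct_smul]
  have h3 : HasDerivAt (fun t : ℝ =>
      eigenEquation X Δ Ψ (0, (Ψ, (lam : ℂ))) + t • eigenLinearization X lam Ψ y +
        (t * t) • ((-(y.2 • y.1), 0) : (System n → ℂ) × ℂ)) (eigenLinearization X lam Ψ y) 0 := by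
    have hquad : ∀ v w : (System n → ℂ) × ℂ,
        HasDerivAt (fun t : ℝ => eigenEquation X Δ Ψ (0, (Ψ, (lam : ℂ))) + t • v + (t * t) • w)
          v 0 := by
      intro v w
      have e1 := (hasDerivAt_id (0 : ℝ)).smul_const v
      have e2 := ((hasDerivAt_id (0 : ℝ)).mul (hasDerivAt_id (0 : ℝ))).smul_const w
      have e3 := (e1.const_add (eigenEquation X Δ Ψ (0, (Ψ, (lam : ℂ))))).add e2
      simp only [id, one_smul, mul_zero, zero_mul, add_zero, zero_smul] at e3
      exact e3
    exact hquad _ _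
  rw [hform] at h2
  exact h2.unique h3

theorem exists_isEigenvalueBranch (hX : X.IsHermitian) (hΔ : ∀ i, (Δ i).IsHermitian)
    (hΨ : ∑ s, ‖Ψ s‖ ^ 2 = 1) (hXΨ : X *ᵥ Ψ = (lam : ℂ) • Ψ)
    (hs : ∀ v, X *ᵥ v = (lam : ℂ) • v → ∃ c : ℂ, v = c • Ψ) :
    ∃ f ψ g, IsEigenvalueBranch X Δ lam Ψ f ψ g := by
  set u : EuclideanSpace ℝ (Fin d) × ((System n → ℂ) × ℂ) := (0, (Ψ, (lam : ℂ))) with hu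
  have hF : HasStrictFDerivAt (eigenEquation X Δ Ψ) (fderiv ℝ (eigenEquation X Δ Ψ) u) u :=
    contDiff_eigenEquation.contDiffAt.hasStrictFDerivAt one_ne_zero
  have hinv : (fderiv ℝ (eigenEquation X Δ Ψ) u ∘L
      .inr ℝ (EuclideanSpace ℝ (Fin d)) ((System n → ℂ) × ℂ)).IsInvertible := by
    -- In finite dimension an injective endomorphism is invertible.
    refine ⟨(LinearEquiv.ofInjectiveEndo (eigenLinearization X lam Ψ)
      (eigenLinearization_injective hX hΨ hXΨ hs)).toContinuousLinearEquiv, ?_⟩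
    refine ContinuousLinearMap.ext fun y => ?_
    exact (fderiv_eigenEquation_inr y).symm
  set φ := hF.implicitFunctionOfProdDomain hinv with hφ
  have hφ0 : φ 0 = (Ψ, (lam : ℂ)) :=
    (hF.eventually_apply_eq_iff_implicitFunctionOfProdDomain hinv).self_of_nhds.1 rfl
  have hφd : DifferentiableAt ℝ φ 0 :=
    (hF.hasStrictFDerivAt_implicitFunctionOfProdDomain hinv).hasFDerivAt.differentiableAt
  have hsol : ∀ᶠ x in 𝓝 0, eigenEquation X Δ Ψ (x, φ x) = eigenEquation X Δ Ψ u :=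
    hF.eventually_apply_implicitFunctionOfProdDomain hinv
  have hu0 : eigenEquation X Δ Ψ u = (0, 1) := by
    simp [eigenEquation, hu, perturbed, hXΨ, star_dotProduct_self hΨ]
  have hfd : DifferentiableAt ℝ (fun x => (φ x).2.re) 0 :=
    Complex.reCLM.differentiableAt.comp (0 : EuclideanSpace ℝ (Fin d)) hφd.snd
  refine ⟨fun x => (φ x).2.re, fun x => (φ x).1, gradient (fun x => (φ x).2.re) 0, ?_, ?_, ?_, ?_,
    hfd.hasGradientAt⟩
  · filter_upwards [hsol] with x hx
    rw [hu0] at hx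
    obtain ⟨h1, h2⟩ := Prod.ext_iff.1 hx
    simp only [eigenEquation] at h1 h2
    rw [sub_eq_zero] at h1
    -- A zero vector would violate the normalization `star Ψ ⬝ᵥ v = 1`.
    have hv : (φ x).1 ≠ 0 := by
      intro h
      simp [h] at h2
    rwa [ofReal_re_of_mulVec_eq_smul (perturbed_isHermitian hX hΔ x) hv h1]
  · simp [hφ0]
  · simp [hφ0]
  · exact hφd.fst.continuousAt

end Perturbation

/-! ### Time evolution -/

section TimeEvolution

open scoped Matrix.Norms.Operator in
theorem exp_mulVec_eq_smul {m : Type*} [Fintype m] [DecidableEq m] {A : Matrix m m ℂ} {v : m → ℂ}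
    {c : ℂ} (h : A *ᵥ v = c • v) : NormedSpace.exp A *ᵥ v = Complex.exp c • v := by
  have hpow : ∀ l : ℕ, (A ^ l) *ᵥ v = c ^ l • v := by
    intro l
    induction l with
    | zero => simp
    | succ l ih =>
      rw [pow_succ, ← Matrix.mulVec_mulVec, h, Matrix.mulVec_smul, ih, smul_smul, pow_succ, mul_comm]
  have h1 : HasSum (fun l : ℕ => ((l.factorial : ℂ)⁻¹ • A ^ l) *ᵥ v) (NormedSpace.exp A *ᵥ v) :=
    (NormedSpace.exp_series_hasSum_exp' (𝕂 := ℂ) A).map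
      (AddMonoidHom.mk' (fun B : Matrix m m ℂ => B *ᵥ v) fun B C => Matrix.add_mulVec B C v)
      (continuous_id.matrix_mulVec continuous_const)
  have h2 : HasSum (fun l : ℕ => ((l.factorial : ℂ)⁻¹ • c ^ l) • v) (NormedSpace.exp c • v) :=
    (NormedSpace.exp_series_hasSum_exp' (𝕂 := ℂ) c).smul_const v
  rw [Complex.exp_eq_exp_ℂ]
  refine h1.unique ?_
  convert h2 using 2 with l
  rw [Matrix.smul_mulVec, hpow, smul_assoc]

-- The exponent is skew-Hermitian, so the adjoint of its exponential is the inverse.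
open scoped Matrix.Norms.Operator in
theorem exp_mul_I_smul_mem_unitaryGroup {m : Type*} [Fintype m] [DecidableEq m] {A : Matrix m m ℂ}
    (hA : A.IsHermitian) (t : ℝ) :
    NormedSpace.exp (((t : ℂ) * Complex.I) • A) ∈ Matrix.unitaryGroup m ℂ := by
  rw [Matrix.mem_unitaryGroup_iff, Matrix.star_eq_conjTranspose, ← Matrix.exp_conjTranspose,
    Matrix.conjTranspose_smul, hA.eq]
  have : star ((t : ℂ) * Complex.I) = -((t : ℂ) * Complex.I) := by simp
  rw [this, neg_smul, Matrix.exp_neg]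
  exact Matrix.mul_nonsing_inv _ ((Matrix.isUnit_iff_isUnit_det _).1 (Matrix.isUnit_exp _))

variable {n d k : ℕ} {X : Matrix (System n) (System n) ℂ}
  {Δ : Fin d → Matrix (System n) (System n) ℂ} {lam : ℝ} {Ψ : System n → ℂ}
  {f : EuclideanSpace ℝ (Fin d) → ℝ} {ψ : EuclideanSpace ℝ (Fin d) → System n → ℂ}
  {g : EuclideanSpace ℝ (Fin d)}

theorem gridPoint_eq_smul (L : ℝ) (ε : Fin d → Fin (2 ^ k)) :
    gridPoint L ε = L • gridPoint 1 ε := by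
  ext i
  simp only [gridPoint, PiLp.smul_apply, smul_eq_mul]
  ring

theorem tendsto_gridPoint (ε : Fin d → Fin (2 ^ k)) :
    Tendsto (fun L : ℝ => gridPoint L ε) (𝓝[>] 0) (𝓝 0) := by
  rw [show (fun L : ℝ => gridPoint L ε) = fun L : ℝ => L • gridPoint 1 ε from
    funext fun L => gridPoint_eq_smul L ε]
  have : Tendsto (fun L : ℝ => L • gridPoint 1 ε) (𝓝 0) (𝓝 ((0 : ℝ) • gridPoint 1 ε)) :=
    tendsto_id.smul_const _
  rw [zero_smul] at this
  exact this.mono_left nhdsWithin_le_nhds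

theorem eventually_isPhaseOracle_timeEvolution (hX : X.IsHermitian) (hΔ : ∀ i, (Δ i).IsHermitian)
    (h : IsEigenvalueBranch X Δ lam Ψ f ψ g) (W : ℝ) :
    ∀ᶠ L in 𝓝[>] (0 : ℝ), IsPhaseOracle (k := k) f ψ W L (timeEvolution X Δ W L) := by
  have h1 : ∀ᶠ L in 𝓝[>] (0 : ℝ), ∀ ε : Fin d → Fin (2 ^ k),
      perturbed X Δ (gridPoint L ε) *ᵥ ψ (gridPoint L ε) =
        ((f (gridPoint L ε) : ℝ) : ℂ) • ψ (gridPoint L ε) :=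
    -- There are finitely many grid points and each tends to `0`, so one neighbourhood of `0` serves
    -- all of them.
    eventually_all.2 fun ε => (tendsto_gridPoint ε).eventually h.eigen
  filter_upwards [h1] with L hL ε
  refine ⟨exp_mul_I_smul_mem_unitaryGroup (perturbed_isHermitian hX hΔ _) _, ?_⟩
  refine exp_mulVec_eq_smul ?_
  rw [Matrix.smul_mulVec, hL, smul_smul]
  congr 1
  push_cast
  ring

/-! ### Convergence of the output state -/

theorem tendsto_slope_gridPoint (h : IsEigenvalueBranch X Δ lam Ψ f ψ g)
    (ε : Fin d → Fin (2 ^ k)) :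
    Tendsto (fun L : ℝ => L⁻¹ * (f (gridPoint L ε) - lam)) (𝓝[>] 0)
      (𝓝 (∑ i, g i * gridPoint 1 ε i)) := by
  have h1 : HasDerivAt (fun L : ℝ => L • gridPoint 1 ε) (gridPoint 1 ε) 0 := by
    simpa using (hasDerivAt_id (0 : ℝ)).smul_const (gridPoint 1 ε)
  have h2 : HasFDerivAt f (InnerProductSpace.toDual ℝ _ g) ((0 : ℝ) • gridPoint 1 ε) := by
    rw [zero_smul]
    exact h.gradient.hasFDerivAt
  have h3 := (h2.comp_hasDerivAt (0 : ℝ) h1).tendsto_slope_zero_right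
  have e : InnerProductSpace.toDual ℝ _ g (gridPoint 1 ε) = ∑ i, g i * gridPoint 1 ε i := by
    rw [InnerProductSpace.toDual_apply_apply, PiLp.inner_apply]
    exact Finset.sum_congr rfl fun i _ => by simp [mul_comm]
  simp only [e, Function.comp_apply, zero_add, zero_smul, h.value_zero, smul_eq_mul] at h3
  refine h3.congr fun L => ?_
  rw [gridPoint_eq_smul L ε]

/-- The phase common to all grid points. -/
def commonPhase (k : ℕ) (W lam : ℝ) (g : EuclideanSpace ℝ (Fin d)) (L : ℝ) : ℝ :=
  2 * Real.pi * (2 ^ k / (W * L)) * lam - Real.pi * 2 ^ k / W * ∑ i, g i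

/-- Subtracting the common phase removes the divergent multiple of `lam`. The grid's centring shift
by `M / 2` contributes only a constant, which `commonPhase` also absorbs. -/
theorem tendsto_phase (h : IsEigenvalueBranch X Δ lam Ψ f ψ g) (W : ℝ) (ε : Fin d → Fin (2 ^ k)) :
    Tendsto (fun L : ℝ => 2 * Real.pi * (2 ^ k / (W * L)) * f (gridPoint L ε)
      - commonPhase k W lam g L) (𝓝[>] 0) (𝓝 (2 * Real.pi / W * ∑ i, g i * ((ε i : ℕ) : ℝ))) := by
  have h1 := ((tendsto_slope_gridPoint h ε).const_mul (2 * Real.pi * 2 ^ k / W)).add_const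
    (Real.pi * 2 ^ k / W * ∑ i, g i)
  have e : 2 * Real.pi * 2 ^ k / W * ∑ i, g i * gridPoint 1 ε i + Real.pi * 2 ^ k / W * ∑ i, g i =
      2 * Real.pi / W * ∑ i, g i * ((ε i : ℕ) : ℝ) := by
    simp only [Finset.mul_sum, ← Finset.sum_add_distrib]
    refine Finset.sum_congr rfl fun i _ => ?_
    simp only [gridPoint]
    have : (2 : ℝ) ^ k ≠ 0 := by positivity
    -- For `W = 0` both sides are zero, by the convention for division by zero.
    rcases eq_or_ne W 0 with rfl | hW
    · simp
    · field_simp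
      ring
  rw [e] at h1
  refine h1.congr fun L => ?_
  rw [commonPhase, mul_comm W L, div_mul_eq_div_div_swap]
  ring

theorem norm_mulVec_apply_le {m : Type*} [Fintype m] [DecidableEq m] {A : Matrix m m ℂ}
    (hA : A ∈ Matrix.unitaryGroup m ℂ) (v : m → ℂ) (s : m) :
    ‖(A *ᵥ v) s‖ ≤ Real.sqrt (∑ t, ‖v t‖ ^ 2) := by
  refine Real.le_sqrt_of_sq_le ?_
  rw [← sum_norm_sq_mulVec hA]
  exact Finset.single_le_sum (f := fun t => ‖(A *ᵥ v) t‖ ^ 2) (fun t _ => by positivity)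
    (Finset.mem_univ s)

theorem tendsto_oracle_mulVec (h : IsEigenvalueBranch X Δ lam Ψ f ψ g) (W : ℝ)
    {U : ℝ → (Fin d → Fin (2 ^ k)) → Matrix (System n) (System n) ℂ}
    (hU : ∀ᶠ L in 𝓝[>] (0 : ℝ), IsPhaseOracle f ψ W L (U L)) (ε : Fin d → Fin (2 ^ k))
    (s : System n) :
    Tendsto (fun L : ℝ => Complex.exp (((-commonPhase k W lam g L : ℝ) : ℂ) * Complex.I) *
      (U L ε *ᵥ Ψ) s) (𝓝[>] 0)
      (𝓝 (Complex.exp (((2 * Real.pi / W * ∑ i, g i * ((ε i : ℕ) : ℝ) : ℝ) : ℂ) * Complex.I)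
        * Ψ s)) := by
  have hψ : Tendsto (fun L : ℝ => ψ (gridPoint L ε)) (𝓝[>] 0) (𝓝 Ψ) := by
    have := h.continuousAt.tendsto.comp (tendsto_gridPoint ε)
    rwa [h.vector_zero] at this
  have hψs : ∀ t, Tendsto (fun L : ℝ => ψ (gridPoint L ε) t) (𝓝[>] 0) (𝓝 (Ψ t)) :=
    fun t => (continuous_apply t).continuousAt.tendsto.comp hψ
  have hphase : Tendsto (fun L : ℝ => Complex.exp (((2 * Real.pi * (2 ^ k / (W * L)) *
      f (gridPoint L ε) - commonPhase k W lam g L : ℝ) : ℂ) * Complex.I)) (𝓝[>] 0)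
      (𝓝 (Complex.exp (((2 * Real.pi / W * ∑ i, g i * ((ε i : ℕ) : ℝ) : ℝ) : ℂ) * Complex.I))) := by
    have hc : Continuous fun t : ℝ => Complex.exp ((t : ℂ) * Complex.I) := by fun_prop
    exact (hc.tendsto _).comp (tendsto_phase h W ε)
  have hmain := hphase.mul (hψs s)
  have hbound : Tendsto (fun L : ℝ => Real.sqrt (∑ t, ‖Ψ t - ψ (gridPoint L ε) t‖ ^ 2)) (𝓝[>] 0)
      (𝓝 0) := by
    have h1 : Tendsto (fun L : ℝ => ∑ t, ‖Ψ t - ψ (gridPoint L ε) t‖ ^ 2) (𝓝[>] 0)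
        (𝓝 (∑ t : System n, ‖Ψ t - Ψ t‖ ^ 2)) :=
      tendsto_finsetSum _ fun t _ => ((tendsto_const_nhds.sub (hψs t)).norm.pow 2)
    have h2 := h1.sqrt
    simpa using h2
  -- On `Ψ - ψ (gridPoint L ε)` nothing is known about the oracle except that it is unitary, and
  -- this suffices.
  have herr : Tendsto (fun L : ℝ => Complex.exp (((-commonPhase k W lam g L : ℝ) : ℂ) * Complex.I) *
      (U L ε *ᵥ (Ψ - ψ (gridPoint L ε))) s) (𝓝[>] 0) (𝓝 0) := by
    refine squeeze_zero_norm' ?_ hbound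
    filter_upwards [hU] with L hL
    rw [norm_mul, Complex.norm_exp_ofReal_mul_I, one_mul]
    exact norm_mulVec_apply_le (hL ε).1 _ s
  have hadd := herr.add hmain
  rw [zero_add] at hadd
  refine hadd.congr' ?_
  filter_upwards [hU] with L hL
  have e : Complex.exp (((2 * Real.pi * (2 ^ k / (W * L)) *
      f (gridPoint L ε) - commonPhase k W lam g L : ℝ) : ℂ) * Complex.I) =
      Complex.exp (((-commonPhase k W lam g L : ℝ) : ℂ) * Complex.I) *
        Complex.exp (((2 * Real.pi * (2 ^ k / (W * L)) * f (gridPoint L ε) : ℝ) : ℂ)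
          * Complex.I) := by
    rw [← Complex.exp_add]
    congr 1
    push_cast
    ring
  rw [Matrix.mulVec_sub, (hL ε).2, e, Pi.sub_apply, Pi.smul_apply, smul_eq_mul]
  ring

/-- The plane wave is a product over the components, so the sum over all `ε` factorizes into
one-dimensional transforms. -/
theorem idealAmplitude_eq_sum (W : ℝ) (g : EuclideanSpace ℝ (Fin d)) (a : Answer d k) :
    idealAmplitude W g a = ∑ ε : Fin d → Fin (2 ^ k),
      ((1 / Real.sqrt 2 : ℝ) : ℂ) ^ (d * k) * (∏ i, invQFT (2 ^ k) (a.value i) (ε i)) *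
        Complex.exp (((2 * Real.pi / W * ∑ i, g i * ((ε i : ℕ) : ℝ) : ℝ) : ℂ) * Complex.I) := by
  have hs : ((1 / Real.sqrt 2 : ℝ) : ℂ) ^ k * ((1 / Real.sqrt (2 ^ k : ℕ) : ℝ) : ℂ) =
      1 / (2 ^ k : ℂ) := by
    have : Real.sqrt (2 ^ k : ℕ) = Real.sqrt 2 ^ k := by
      push_cast
      rw [Real.sqrt_eq_iff_mul_self_eq (by positivity) (by positivity), ← mul_pow,
        Real.mul_self_sqrt (by norm_num)]
    rw [this, ← Complex.ofReal_pow, ← Complex.ofReal_mul, div_pow, one_pow, div_mul_div_comm,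
      ← mul_pow, Real.mul_self_sqrt (by norm_num)]
    push_cast
    ring
  have hk : ((1 / Real.sqrt 2 : ℝ) : ℂ) ^ (d * k) =
      ∏ _i : Fin d, ((1 / Real.sqrt 2 : ℝ) : ℂ) ^ k := by
    rw [Finset.prod_const, Finset.card_univ, Fintype.card_fin, ← pow_mul, mul_comm]
  have hexp : ∀ ε : Fin d → Fin (2 ^ k),
      Complex.exp (((2 * Real.pi / W * ∑ i, g i * ((ε i : ℕ) : ℝ) : ℝ) : ℂ) * Complex.I) =
        ∏ i, Complex.exp (((2 * Real.pi / W * (g i * ((ε i : ℕ) : ℝ)) : ℝ) : ℂ) * Complex.I) := by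
    intro ε
    rw [← Complex.exp_sum, Finset.mul_sum, Complex.ofReal_sum, Finset.sum_mul]
  simp only [hk, hexp, ← Finset.prod_mul_distrib]
  rw [idealAmplitude, ← Fintype.prod_sum (fun i (l : Fin (2 ^ k)) =>
    ((1 / Real.sqrt 2 : ℝ) : ℂ) ^ k * invQFT (2 ^ k) (a.value i) l *
      Complex.exp (((2 * Real.pi / W * (g i * ((l : ℕ) : ℝ)) : ℝ) : ℂ) * Complex.I))]
  refine Finset.prod_congr rfl fun i _ => ?_
  rw [Finset.mul_sum]
  refine Finset.sum_congr rfl fun l _ => ?_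
  rw [invQFT, Matrix.of_apply, ← mul_assoc, hs, mul_assoc (1 / 2 ^ k : ℂ) (Complex.exp _),
    ← Complex.exp_add]
  congr 2
  push_cast
  have : (2 : ℂ) ^ k ≠ 0 := pow_ne_zero _ two_ne_zero
  field_simp
  ring

theorem tendsto_outputState_apply (h : IsEigenvalueBranch X Δ lam Ψ f ψ g) (W : ℝ)
    {U : ℝ → (Fin d → Fin (2 ^ k)) → Matrix (System n) (System n) ℂ}
    (hU : ∀ᶠ L in 𝓝[>] (0 : ℝ), IsPhaseOracle f ψ W L (U L)) (a : Answer d k) (s : System n) :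
    Tendsto (fun L : ℝ => Complex.exp (((-commonPhase k W lam g L : ℝ) : ℂ) * Complex.I) *
      outputState (U L) Ψ (a, s)) (𝓝[>] 0) (𝓝 (idealAmplitude W g a * Ψ s)) := by
  have h1 := tendsto_finsetSum Finset.univ fun (ε : Fin d → Fin (2 ^ k)) _ =>
    (tendsto_oracle_mulVec h W hU ε s).const_mul
      (((1 / Real.sqrt 2 : ℝ) : ℂ) ^ (d * k) * (∏ i, invQFT (2 ^ k) (a.value i) (ε i)))
  rw [idealAmplitude_eq_sum, Finset.sum_mul]
  simp only [← mul_assoc] at h1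
  refine h1.congr fun L => ?_
  rw [outputState_apply, Finset.mul_sum]
  exact Finset.sum_congr rfl fun ε _ => by ring

/-- The phase need not converge, so it is moved onto the limit vector; having modulus one, it does
not change the norm of the difference. -/
theorem tendsto_outputState_sub (h : IsEigenvalueBranch X Δ lam Ψ f ψ g) (W : ℝ)
    {U : ℝ → (Fin d → Fin (2 ^ k)) → Matrix (System n) (System n) ℂ}
    (hU : ∀ᶠ L in 𝓝[>] (0 : ℝ), IsPhaseOracle f ψ W L (U L)) :
    Tendsto (fun L => outputState (U L) Ψ
      - Complex.exp ((commonPhase k W lam g L : ℂ) * Complex.I) •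
        fun p : Answer d k × System n => idealAmplitude W g p.1 * Ψ p.2) (𝓝[>] 0) (𝓝 0) := by
  refine tendsto_pi_nhds.2 fun ⟨a, s⟩ => ?_
  have h1 := (tendsto_outputState_apply h W hU a s).sub_const (idealAmplitude W g a * Ψ s)
  rw [sub_self] at h1
  refine squeeze_zero_norm (fun L => le_of_eq ?_) (by simpa using h1.norm)
  rw [← one_mul ‖Complex.exp _ * _ - _‖,
    ← Complex.norm_exp_ofReal_mul_I (commonPhase k W lam g L), ← norm_mul, mul_sub, ← mul_assoc,
    ← Complex.exp_add]
  simp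

theorem tendsto_measureProb (hΨ : ∑ s, ‖Ψ s‖ ^ 2 = 1) (h : IsEigenvalueBranch X Δ lam Ψ f ψ g)
    (W : ℝ) {U : ℝ → (Fin d → Fin (2 ^ k)) → Matrix (System n) (System n) ℂ}
    (hU : ∀ᶠ L in 𝓝[>] (0 : ℝ), IsPhaseOracle f ψ W L (U L)) (S : Set (Answer d k)) :
    Tendsto (fun L => measureProb (outputState (U L) Ψ) S) (𝓝[>] 0)
      (𝓝 (∑ a, S.indicator (fun a => ‖idealAmplitude W g a‖ ^ 2) a)) := by
  refine tendsto_finsetSum _ fun a _ => ?_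
  by_cases ha : a ∈ S
  · simp only [Set.indicator_of_mem ha]
    have h1 : Tendsto (fun L => ∑ s, ‖Complex.exp (((-commonPhase k W lam g L : ℝ) : ℂ) * Complex.I) *
        outputState (U L) Ψ (a, s)‖ ^ 2) (𝓝[>] 0) (𝓝 (∑ s, ‖idealAmplitude W g a * Ψ s‖ ^ 2)) :=
      tendsto_finsetSum _ fun s _ => (tendsto_outputState_apply h W hU a s).norm.pow 2
    simpa only [norm_mul, Complex.norm_exp_ofReal_mul_I, one_mul, mul_pow, ← Finset.mul_sum, hΨ,
      mul_one] using h1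
  · simp only [Set.indicator_of_notMem ha]
    exact tendsto_const_nhds

theorem tendsto_measureProb_singleton (hΨ : ∑ s, ‖Ψ s‖ ^ 2 = 1)
    (h : IsEigenvalueBranch X Δ lam Ψ f ψ g)
    (W : ℝ) {U : ℝ → (Fin d → Fin (2 ^ k)) → Matrix (System n) (System n) ℂ}
    (hU : ∀ᶠ L in 𝓝[>] (0 : ℝ), IsPhaseOracle f ψ W L (U L)) (a : Answer d k) :
    Tendsto (fun L => measureProb (outputState (U L) Ψ) {a}) (𝓝[>] 0)
      (𝓝 (‖idealAmplitude W g a‖ ^ 2)) := by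
  have h1 := tendsto_measureProb hΨ h W hU {a}
  rwa [Finset.sum_eq_single a (fun b _ hb => Set.indicator_of_notMem (by simpa using hb) _)
    (by simp), Set.indicator_of_mem (Set.mem_singleton a)] at h1

end TimeEvolution

/-! ### Unitarity of the gradient circuit -/

theorem kronecker_one_mem_unitaryGroup {α β : Type*} [Fintype α] [DecidableEq α] [Fintype β]
    [DecidableEq β] {A : Matrix α α ℂ} (hA : A ∈ Matrix.unitaryGroup α ℂ) :
    A ⊗ₖ (1 : Matrix β β ℂ) ∈ Matrix.unitaryGroup (α × β) ℂ :=
  Matrix.kronecker_mem_unitary hA (one_mem _)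

theorem eval_gradientCircuit_mem_unitaryGroup {n d k : ℕ}
    {U : (Fin d → Fin (2 ^ k)) → Matrix (System n) (System n) ℂ}
    (hU : ∀ ε, U ε ∈ Matrix.unitaryGroup (System n) ℂ) :
    eval U (gradientCircuit d k) ∈ Matrix.unitaryGroup (Answer d k × System n) ℂ := by
  refine eval_mem_unitaryGroup fun g _ => ?_
  cases g with
  | hadamard w =>
    refine kronecker_one_mem_unitaryGroup ?_
    rw [hadamardOn_eq]
    exact siteOp_mem_unitaryGroup w hadamardMatrix_mem_unitaryGroup
  | invQFT i =>
    refine kronecker_one_mem_unitaryGroup ?_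
    rw [invQFTOn_eq]
    exact submatrix_mem_unitaryGroup _ (siteOp_mem_unitaryGroup i
      (invQFT_mem_unitaryGroup (by positivity)))
  | oracle => exact controlled_mem_unitaryGroup hU

end QGrad

end

/-! ### Assembly of the theorem -/

theorem mainTheorem3 (n d k : ℕ)
    (X : Matrix (QGrad.System n) (QGrad.System n) ℂ) (hX : X.IsHermitian)
    (Δ : Fin d → Matrix (QGrad.System n) (QGrad.System n) ℂ) (hΔ : ∀ i, (Δ i).IsHermitian)
    (lam : ℝ) (Ψ : QGrad.System n → ℂ) (hΨ : ∑ s, ‖Ψ s‖ ^ 2 = 1)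
    (hXΨ : X *ᵥ Ψ = (lam : ℂ) • Ψ) :
    -- resources: one query, a register of `n` and a register of `d * k` qubits, unitary circuit
    QGrad.queries (QGrad.gradientCircuit d k) = 1 ∧
    Real.logb 2 (Fintype.card (QGrad.System n)) = n ∧
    Real.logb 2 (Fintype.card (QGrad.Answer d k)) = (d * k : ℕ) ∧
    (∀ U : (Fin d → Fin (2 ^ k)) → Matrix (QGrad.System n) (QGrad.System n) ℂ,
      (∀ ε, U ε ∈ Matrix.unitaryGroup (QGrad.System n) ℂ) →
      QGrad.eval U (QGrad.gradientCircuit d k) ∈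
        Matrix.unitaryGroup (QGrad.Answer d k × QGrad.System n) ℂ) ∧
    -- a simple eigenvalue has a gradient
    ((∀ v, X *ᵥ v = (lam : ℂ) • v → ∃ c : ℂ, v = c • Ψ) →
      ∃ f ψ g, QGrad.IsEigenvalueBranch X Δ lam Ψ f ψ g) ∧
    -- the circuit finds the gradient
    ∀ f ψ g, QGrad.IsEigenvalueBranch X Δ lam Ψ f ψ g → ∀ W : ℝ, 0 < W →
      (∀ᶠ L in 𝓝[>] (0 : ℝ),
        QGrad.IsPhaseOracle (k := k) f ψ W L (QGrad.timeEvolution X Δ W L)) ∧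
      ∀ U : ℝ → (Fin d → Fin (2 ^ k)) → Matrix (QGrad.System n) (QGrad.System n) ℂ,
        (∀ᶠ L in 𝓝[>] (0 : ℝ), QGrad.IsPhaseOracle f ψ W L (U L)) →
        (∃ α : ℝ → ℂ, (∀ L, ‖α L‖ = 1) ∧
          Tendsto
            (fun L => QGrad.outputState (U L) Ψ
              - α L • fun p : QGrad.Answer d k × QGrad.System n =>
                  QGrad.idealAmplitude W g p.1 * Ψ p.2)
            (𝓝[>] 0) (𝓝 0)) ∧
        (∀ a : QGrad.Answer d k,
          Tendsto (fun L => QGrad.measureProb (QGrad.outputState (U L) Ψ) {a})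
            (𝓝[>] 0) (𝓝 (‖QGrad.idealAmplitude W g a‖ ^ 2))) ∧
        (∀ a ∈ QGrad.accurate (k := k) W g 0,
          Tendsto (fun L => QGrad.measureProb (QGrad.outputState (U L) Ψ) {a})
            (𝓝[>] 0) (𝓝 1)) ∧
        (∀ a ∈ QGrad.accurate (k := k) W g (W / (2 * 2 ^ k)), ∀ η : ℝ, 0 < η →
          ∀ᶠ L in 𝓝[>] (0 : ℝ), (4 / Real.pi ^ 2) ^ d - η ≤
            QGrad.measureProb (QGrad.outputState (U L) Ψ) {a}) ∧
        (∀ r : ℝ, 1 < r → ∀ η : ℝ, 0 < η →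
          ∀ᶠ L in 𝓝[>] (0 : ℝ), 1 - d / (2 * (r - 1)) - η ≤
            QGrad.measureProb (QGrad.outputState (U L) Ψ)
              (QGrad.accurate W g (r * W / 2 ^ k))) := by
  refine ⟨QGrad.queries_gradientCircuit, ?_, ?_,
    fun U hU => QGrad.eval_gradientCircuit_mem_unitaryGroup hU,
    fun hs => QGrad.exists_isEigenvalueBranch hX hΔ hΨ hXΨ hs, fun f ψ g h W hW =>
    ⟨QGrad.eventually_isPhaseOracle_timeEvolution hX hΔ h W, fun U hU =>
    ⟨⟨fun L => Complex.exp ((QGrad.commonPhase k W lam g L : ℂ) * Complex.I),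
      fun L => Complex.norm_exp_ofReal_mul_I _, QGrad.tendsto_outputState_sub h W hU⟩,
    fun a => QGrad.tendsto_measureProb_singleton hΨ h W hU a, fun a ha => ?_, fun a ha η hη => ?_,
    fun r hr η hη => ?_⟩⟩⟩
  · simp [Real.logb_pow]
  · simp [Real.logb_pow]
  · rw [← QGrad.norm_sq_idealAmplitude_eq_one hW ha]
    exact QGrad.tendsto_measureProb_singleton hΨ h W hU a
  -- Subtracting `η` puts the bound strictly below the limit, hence eventually below the
  -- probability.
  · refine ((QGrad.tendsto_measureProb_singleton hΨ h W hU a).eventually_const_lt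
      (u := (4 / Real.pi ^ 2) ^ d - η) ?_).mono fun L hL => hL.le
    linarith [QGrad.le_norm_sq_idealAmplitude hW ha]
  · refine ((QGrad.tendsto_measureProb hΨ h W hU _).eventually_const_lt
      (u := 1 - d / (2 * (r - 1)) - η) ?_).mono fun L hL => hL.le
    linarith [QGrad.one_sub_le_sum_norm_sq_idealAmplitude (d := d) (k := k) (g := g) hr hW]
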